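/- Let $n\ge 1$, let $\Lambda\subset\mathbb{R}^n$ be an arbitrary lattice of rank $n$, with determinant $\det\Lambda>0$, and let $K\subset\mathbb{R}^n$ be a convex body (a non-empty compact convex set) with $\dim(K\cap\Lambda)=n$, i.e. $K$ contains $n+1$ affinely independent points of $\Lambda$. Then $K\cap\Lambda$ is finite and $$\#(K\cap\Lambda)\;\le\;\frac{\mathrm{vol}(K)}{\det\Lambda}+\bigl(\mu(\Lambda)\,\lambda_1(\Lambda^\star)+1\bigr)\,(n-1)!\,\frac{\mathrm{F}(K)}{\det\Lambda_{n-1}}.$$ Here $\mathrm{vol}$ is Lebesgue measure; $\mathrm{F}(K)$ is the surface area of $K$, i.e. the $(n-1)$-dimensional Hausdorff measure of the boundary of $K$, normalized to agree with Lebesgue measure on $(n-1)$-dimensional Euclidean spaces; $\Lambda^\star=\{y\in\mathbb{R}^n : y\cdot b\in\mathbb{Z}\text{ for all }b\in\Lambda\}$ is the polar lattice; $\lambda_1(\Lambda^\star)$ is the Euclidean length of a shortest non-zero vector of $\Lambda^\star$; $\mu(\Lambda)$ is the inhomogeneous minimum of $\Lambda$, i.e. the smallest radius of a ball containing the Dirichlet-Voronoi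 cell $\{x\in\mathbb{R}^n : \|x\|\le\|x-b\|\text{ for all }b\in\Lambda\}$; and $\det\Lambda_{n-1}$ is the minimal determinant of an $(n-1)$-dimensional sublattice of $\Lambda$, where the determinant of a lattice with $\mathbb{Z}$-basis $b_1,\dots,b_k$ is $\sqrt{\det(b_i\cdot b_j)_{i,j}}$ (equal to $1$ if $k=0$). -/

import Mathlib

open MeasureTheory Module
open scoped RealInnerProductSpace Nat

namespace LatticeGeometry

variable {n : ℕ}

/-- The polar lattice `Λ* = {y : ⟪y, b⟫ ∈ ℤ for all b ∈ Λ}`. -/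
def polarLattice (L : Submodule ℤ (EuclideanSpace ℝ (Fin n))) :
    Submodule ℤ (EuclideanSpace ℝ (Fin n)) where
  carrier := {y | ∀ b ∈ L, ∃ k : ℤ, ⟪y, b⟫ = (k : ℝ)}
  add_mem' := by
    intro x y hx hy b hb
    obtain ⟨k, hk⟩ := hx b hb
    obtain ⟨l, hl⟩ := hy b hb
    exact ⟨k + l, by rw [inner_add_left, hk, hl]; push_cast; rfl⟩
  zero_mem' := fun b _ => ⟨0, by simp⟩
  smul_mem' := by
    intro c x hx b hb
    obtain ⟨k, hk⟩ := hx b hb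
    refine ⟨c * k, ?_⟩
    rw [← Int.cast_smul_eq_zsmul ℝ c x, real_inner_smul_left, hk]
    push_cast
    rfl

/-- `λ₁(Λ)`: the length of a shortest non-zero vector of `Λ`. -/
noncomputable def firstMinimum (L : Submodule ℤ (EuclideanSpace ℝ (Fin n))) : ℝ :=
  sInf {r : ℝ | ∃ v ∈ L, v ≠ 0 ∧ r = ‖v‖}

/-- The Dirichlet-Voronoi cell of `Λ`: the points for which the origin is a nearest
lattice point. -/
def dirichletVoronoiCell (L : Submodule ℤ (EuclideanSpace ℝ (Fin n))) :
    Set (EuclideanSpace ℝ (Fin n)) :=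
  {x | ∀ b ∈ L, ‖x‖ ≤ ‖x - b‖}

/-- The inhomogeneous minimum `μ(Λ)`: the smallest radius of a ball (with any centre) containing
the Dirichlet-Voronoi cell. -/
noncomputable def inhomogeneousMinimum (L : Submodule ℤ (EuclideanSpace ℝ (Fin n))) : ℝ :=
  sInf {r : ℝ | ∃ c : EuclideanSpace ℝ (Fin n),
    dirichletVoronoiCell L ⊆ Metric.closedBall c r}

/-- The determinants of the `k`-dimensional sublattices `M` of `Λ`. The determinant of a lattice
`M` of rank `k` is the `k`-dimensional volume of the parallelepiped spanned by a `ℤ`-basis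
`b₁, …, b_k` of `M`, that is, `√det (⟪bᵢ, bⱼ⟫)`; it does not depend on the basis. -/
def sublatticeDets (L : Submodule ℤ (EuclideanSpace ℝ (Fin n))) (k : ℕ) : Set ℝ :=
  {d : ℝ | ∃ M : Submodule ℤ (EuclideanSpace ℝ (Fin n)), M ≤ L ∧
    ∃ b : Basis (Fin k) ℤ M,
      d = √(Matrix.gram ℝ (fun i => (b i : EuclideanSpace ℝ (Fin n)))).det}

/-- The minimal determinant `det Λ_k` of a `k`-dimensional sublattice of `Λ`. -/
noncomputable def minSublatticeDet (L : Submodule ℤ (EuclideanSpace ℝ (Fin n))) (k : ℕ) : ℝ :=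
  sInf (sublatticeDets L k)

/-- The surface area `F(K)` of a convex body with interior points in `ℝⁿ`: the `(n-1)`-dimensional
Hausdorff measure of its boundary, normalized to agree with Lebesgue measure on
`(n-1)`-dimensional Euclidean spaces. -/
noncomputable def surfaceArea (K : ConvexBody (EuclideanSpace ℝ (Fin n))) : ℝ :=
  (Measure.euclideanHausdorffMeasure (n - 1)
    (frontier (K : Set (EuclideanSpace ℝ (Fin n))))).toReal

end LatticeGeometry

/-! Let `P` be the convex hull of the lattice points of `K`, write `n = d + 1`, and move the lattice
points of `P` by a suitable small vector `t`. The average over `t` of the number of `z ∈ Λ` with `z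
+ t ∈ P` is `vol P / det Λ`. Hence some `t` in the Dirichlet-Voronoi cell, which may also be chosen
off all lines through nonzero lattice vectors when `d > 0`, gives at most that many
(`exists_translate_ncard_le`). This `t` has length at most `μ(Λ)`.

Triangulate the boundary of `P` by `N` lattice simplices (`exists_boundary_triangulation`). Let
`s_k` be the root of the Gram determinant of the edge vectors of the `k`-th simplex, that is, `d!`
times its area. A lattice point `z` of `P` with `z + t ∉ P` is either on the boundary or interior. *
The boundary points number at most `N`. Each `s_k` is the determinant of a `d`-dimensional
sublattice, so `s_k ≥ det Λ_d` and `N ≤ ∑ s_k / det Λ_d`. * For an interior point, the segment from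
`z` to `z + t` crosses one of the simplices. At most `|det (t, edges)| / det Λ ≤ μ(Λ) s_k / det Λ`
points cross the `k`-th one (`card_crossing_le`).

Since `det Λ_d = λ₁(Λ*) det Λ` (`minSublatticeDet_eq`), both contributions are multiples of `∑ s_k /
det Λ_d`, with factors `1` and `μ(Λ) λ₁(Λ*)`. Finally `∑ s_k ≤ d! F(K)` (`sum_sqrt_det_gram_le`):
the prisms erected over the simplices along the outer normals are disjoint, and orthogonal
projection, which does not increase area, maps the part of the boundary of `K` in each prism onto
the simplex below it.

The triangulation comes from polarity. Perturbing the right-hand sides of the inequalities that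
define the polar of `P` gives a simple polytope, whose vertices correspond to the simplices.
Counting incidences of vertices and facets gives at least as many simplices as boundary lattice
points. -/

namespace LatticeGeometry

/-! ### Polyhedra with generic right-hand side: vertices, tight constraints, normal cones. -/

section Polar

variable {E : Type*} [NormedAddCommGroup E] [InnerProductSpace ℝ E] {ι : Type*}

/-- The polyhedron `{y : ⟪y, wᵢ⟫ ≤ hᵢ for all i}`. -/
def polyhedron (w : ι → E) (h : ι → ℝ) : Set E := {y | ∀ i, ⟪y, w i⟫ ≤ h i}

/-- The indices of the inequalities of `polyhedron w h` which are equalities at `y`. -/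
def tightSet (w : ι → E) (h : ι → ℝ) (y : E) : Set ι := {i | ⟪y, w i⟫ = h i}

lemma isClosed_polyhedron (w : ι → E) (h : ι → ℝ) : IsClosed (polyhedron w h) := by
  simp only [polyhedron, Set.ofPred_forall]
  exact isClosed_iInter fun i => isClosed_le (by fun_prop) continuous_const

lemma convex_polyhedron (w : ι → E) (h : ι → ℝ) : Convex ℝ (polyhedron w h) := by
  intro x hx y hy a b ha hb hab i
  rw [inner_add_left, real_inner_smul_left, real_inner_smul_left]
  have h1 := mul_le_mul_of_nonneg_left (hx i) ha
  have h2 := mul_le_mul_of_nonneg_left (hy i) hb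
  calc _ ≤ a * h i + b * h i := add_le_add h1 h2
    _ = h i := by rw [← add_mul, hab, one_mul]

lemma inner_le_of_mem_convexHull {w : ι → E} {y x : E} {c : ℝ} (h : ∀ i, ⟪y, w i⟫ ≤ c)
    (hx : x ∈ convexHull ℝ (Set.range w)) : ⟪y, x⟫ ≤ c := by
  have hc : Convex ℝ {x : E | ⟪y, x⟫ ≤ c} :=
    convex_halfSpace_le (f := fun x : E => ⟪y, x⟫)
      ⟨fun a b => inner_add_right _ _ _, fun a b => by simp [real_inner_smul_right]⟩ c
  have : Set.range w ⊆ {x : E | ⟪y, x⟫ ≤ c} := by rintro _ ⟨i, rfl⟩; exact h i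
  exact convexHull_min this hc hx

/-- The convex hull of the normals contains a small ball; pairing `y` with the point of that ball in
the direction of `y` bounds the norm of `y`. -/
lemma isCompact_polyhedron [FiniteDimensional ℝ E] [Finite ι] {w : ι → E} (h : ι → ℝ)
    (hw : (0 : E) ∈ interior (convexHull ℝ (Set.range w))) : IsCompact (polyhedron w h) := by
  obtain ⟨δ, hδ, hball⟩ := Metric.mem_nhds_iff.1 (mem_interior_iff_mem_nhds.1 hw)
  obtain ⟨c, hc⟩ := (Set.finite_range h).bddAbove
  refine Metric.isCompact_of_isClosed_isBounded (isClosed_polyhedron w h) ?_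
  refine (Metric.isBounded_iff_subset_closedBall (0 : E)).2 ⟨c / (δ / 2), fun y hy => ?_⟩
  rw [mem_closedBall_zero_iff, le_div_iff₀ (by positivity)]
  have hle : ∀ x ∈ convexHull ℝ (Set.range w), ⟪y, x⟫ ≤ c := fun x hx =>
    inner_le_of_mem_convexHull (fun i => (hy i).trans (hc ⟨i, rfl⟩)) hx
  rcases eq_or_ne y 0 with rfl | hy0
  · simpa using hle 0 (interior_subset hw)
  have hn : 0 < ‖y‖ := norm_pos_iff.2 hy0
  have hx := hle ((δ / 2 / ‖y‖) • y) (hball (by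
    rw [mem_ball_zero_iff, norm_smul, Real.norm_of_nonneg (by positivity),
      div_mul_cancel₀ _ hn.ne']
    linarith))
  rw [real_inner_smul_right, real_inner_self_eq_norm_sq] at hx
  calc ‖y‖ * (δ / 2) = δ / 2 / ‖y‖ * ‖y‖ ^ 2 := by field_simp
    _ ≤ c := hx

/-- Moving slightly from a point of a polyhedron in a direction which does not violate the tight
constraints stays within the polyhedron. -/
lemma exists_add_smul_mem_polyhedron [Finite ι] {w : ι → E} {h : ι → ℝ} {y d : E}
    (hy : y ∈ polyhedron w h) (hd : ∀ i ∈ tightSet w h y, ⟪d, w i⟫ ≤ 0) :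
    ∃ ε > 0, y + (ε : ℝ) • d ∈ polyhedron w h := by
  have key : ∀ i, ∀ᶠ ε in nhdsWithin (0 : ℝ) (Set.Ioi 0), ⟪y + ε • d, w i⟫ ≤ h i := by
    intro i
    by_cases hi : i ∈ tightSet w h y
    · filter_upwards [self_mem_nhdsWithin] with ε hε
      rw [inner_add_left, real_inner_smul_left, show ⟪y, w i⟫ = h i from hi]
      have := mul_nonpos_of_nonneg_of_nonpos (le_of_lt hε) (hd i hi)
      linarith
    · have hlt : ⟪y, w i⟫ < h i := lt_of_le_of_ne (hy i) hi
      have hcont : Continuous fun ε : ℝ => ⟪y + ε • d, w i⟫ := by fun_prop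
      have h0 : ⟪y + (0 : ℝ) • d, w i⟫ < h i := by simpa using hlt
      have := (hcont.tendsto 0).eventually (gt_mem_nhds h0)
      filter_upwards [nhdsWithin_le_nhds this] with ε hε using hε.le
  obtain ⟨ε, h1, h2⟩ := ((Filter.eventually_all.2 key).and self_mem_nhdsWithin).exists
  exact ⟨ε, h2, h1⟩

/-- Otherwise a short step along both `d` and `-d` stays in the polyhedron and puts `y` inside a
segment. -/
lemma eq_zero_of_inner_tightSet_eq_zero [Finite ι] {w : ι → E} {h : ι → ℝ} {y d : E}
    (hy : y ∈ (polyhedron w h).extremePoints ℝ) (hd : ∀ i ∈ tightSet w h y, ⟪d, w i⟫ = 0) :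
    d = 0 := by
  obtain ⟨ε, hε, h1⟩ := exists_add_smul_mem_polyhedron hy.1 (fun i hi => (hd i hi).le)
  obtain ⟨η, hη, h2⟩ := exists_add_smul_mem_polyhedron (d := -d) hy.1
    (fun i hi => by rw [inner_neg_left, hd i hi, neg_zero])
  have hseg : y ∈ openSegment ℝ (y + ε • d) (y + η • -d) := by
    refine ⟨η / (ε + η), ε / (ε + η), by positivity, by positivity, by field_simp; ring, ?_⟩
    have : (η / (ε + η)) • (y + ε • d) + (ε / (ε + η)) • (y + η • -d)
        = ((η / (ε + η)) + ε / (ε + η)) • y +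
          ((η / (ε + η)) * ε - (ε / (ε + η)) * η) • d := by module
    rw [this]
    have e1 : η / (ε + η) + ε / (ε + η) = 1 := by field_simp; ring
    have e2 : (η / (ε + η)) * ε - (ε / (ε + η)) * η = 0 := by field_simp; ring
    rw [e1, e2]; simp
  have := (mem_extremePoints.1 hy).2 _ h1 _ h2 hseg
  have h3 : ε • d = 0 := by simpa using this.1
  exact (smul_eq_zero.1 h3).resolve_left hε.ne'

lemma span_tightSet_eq_top [FiniteDimensional ℝ E] [Finite ι] {w : ι → E} {h : ι → ℝ} {y : E}
    (hy : y ∈ (polyhedron w h).extremePoints ℝ) :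
    Submodule.span ℝ (w '' tightSet w h y) = ⊤ := by
  rw [← Submodule.orthogonal_eq_bot_iff, Submodule.eq_bot_iff]
  intro d hd
  refine eq_zero_of_inner_tightSet_eq_zero hy fun i hi => ?_
  rw [real_inner_comm]
  exact (Submodule.mem_orthogonal _ _).1 hd _ (Submodule.subset_span ⟨i, hi, rfl⟩)

/-- An extreme point is determined by its tight constraints. -/
lemma extremePoint_eq_of_tight [Finite ι] {w : ι → E} {h : ι → ℝ} {y z : E}
    (hy : y ∈ (polyhedron w h).extremePoints ℝ) (hz : tightSet w h y ⊆ tightSet w h z) :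
    z = y := by
  rw [← sub_eq_zero]
  refine eq_zero_of_inner_tightSet_eq_zero hy fun i hi => ?_
  rw [inner_sub_left, show ⟪z, w i⟫ = h i from hz hi, show ⟪y, w i⟫ = h i from hi, sub_self]

lemma finite_extremePoints_polyhedron [Finite ι] (w : ι → E) (h : ι → ℝ) :
    ((polyhedron w h).extremePoints ℝ).Finite := by
  refine Set.Finite.of_finite_image (f := tightSet w h) (Set.toFinite _) ?_
  intro y hy z hz hyz
  exact (extremePoint_eq_of_tight hy hyz.subset).symm

/-- The right-hand side `h` is generic: at each point the tight constraints are linearly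
independent. -/
def IsGeneric (w : ι → E) (h : ι → ℝ) : Prop :=
  ∀ y, LinearIndepOn ℝ w (tightSet w h y)

lemma ncard_tightSet [FiniteDimensional ℝ E] [Finite ι] {w : ι → E} {h : ι → ℝ} {y : E}
    (hg : IsGeneric w h) (hy : y ∈ (polyhedron w h).extremePoints ℝ) :
    (tightSet w h y).ncard = finrank ℝ E := by
  classical
  have := Fintype.ofFinite ι
  have : Fintype (tightSet w h y) := Fintype.ofFinite _
  have h1 := finrank_span_eq_card (hg y).linearIndependent
  have h2 : Set.range (fun i : tightSet w h y => w i) = w '' tightSet w h y := by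
    ext; simp
  rw [h2, span_tightSet_eq_top hy, finrank_top] at h1
  rw [h1, Set.ncard_eq_toFinset_card', Set.toFinset_card]

/-- The cones spanned by the tight constraints at the extreme points have disjoint interiors. -/
lemma extremePoint_unique [FiniteDimensional ℝ E] [Fintype ι] {w : ι → E} {h : ι → ℝ} {y z x : E}
    (hy : y ∈ (polyhedron w h).extremePoints ℝ) (hz : z ∈ (polyhedron w h).extremePoints ℝ)
    {κ : Type*} [Fintype κ] {a b : κ → ι} {l m : κ → ℝ}
    (ha : Set.range a = tightSet w h y) (hb : Set.range b = tightSet w h z)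
    (hl : ∀ k, 0 < l k) (hm : ∀ k, 0 ≤ m k)
    (hxl : ∑ k, l k • w (a k) = x) (hxm : ∑ k, m k • w (b k) = x) : z = y := by
  -- Feasibility of `z` makes `z - y` nonpositive on the cone at `y`; feasibility of `y` makes it
  -- nonnegative on the cone at `z`. As `x` lies in both cones and has positive coefficients in the
  -- first, every constraint tight at `y` is tight at `z`.
  have h1 : ∀ k, ⟪z - y, w (a k)⟫ ≤ 0 := fun k => by
    have e : ⟪y, w (a k)⟫ = h (a k) := ha.subset ⟨k, rfl⟩
    rw [inner_sub_left, e]; exact sub_nonpos.2 (hz.1 _)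
  have h2 : ∀ k, 0 ≤ ⟪z - y, w (b k)⟫ := fun k => by
    have e : ⟪z, w (b k)⟫ = h (b k) := hb.subset ⟨k, rfl⟩
    rw [inner_sub_left, e]; exact sub_nonneg.2 (hy.1 _)
  have h3 : 0 ≤ ⟪z - y, x⟫ := by
    rw [← hxm, inner_sum]
    exact Finset.sum_nonneg fun k _ => by
      rw [real_inner_smul_right]; exact mul_nonneg (hm k) (h2 k)
  have h4 : ∀ k, l k * ⟪z - y, w (a k)⟫ ≤ 0 := fun k =>
    mul_nonpos_of_nonneg_of_nonpos (hl k).le (h1 k)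
  have h5 : ∑ k, l k * ⟪z - y, w (a k)⟫ = ⟪z - y, x⟫ := by
    rw [← hxl, inner_sum]
    exact Finset.sum_congr rfl fun k _ => (real_inner_smul_right _ _ _).symm
  have h6 := (Finset.sum_eq_zero_iff_of_nonpos (fun k _ => h4 k)).1
    (le_antisymm (Finset.sum_nonpos fun k _ => h4 k) (h5 ▸ h3))
  refine extremePoint_eq_of_tight hy fun i hi => ?_
  obtain ⟨k, rfl⟩ := ha.symm.subset hi
  have h7 := (mul_eq_zero.1 (h6 k (Finset.mem_univ k))).resolve_left (hl k).ne'
  rw [inner_sub_left, sub_eq_zero] at h7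
  rw [tightSet, Set.mem_ofPred_eq, h7]
  exact hi

/-- The maximisers form a compact exposed face, and extreme points of a face are extreme in `Q`. -/
lemma exists_extremePoint_isMaxOn [FiniteDimensional ℝ E] {Q : Set E} (hQ : IsCompact Q)
    (hne : Q.Nonempty) (x : E) : ∃ y ∈ Q.extremePoints ℝ, ∀ z ∈ Q, ⟪z, x⟫ ≤ ⟪y, x⟫ := by
  let l : StrongDual ℝ E := innerSL ℝ x
  have h : IsExposed ℝ Q {z ∈ Q | ∀ v ∈ Q, l v ≤ l z} := fun _ => ⟨l, rfl⟩
  obtain ⟨z, hzA, hz⟩ := hQ.exists_isMaxOn hne l.continuous.continuousOn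
  obtain ⟨y, hy⟩ := (h.isCompact hQ).extremePoints_nonempty ⟨z, hzA, hz⟩
  refine ⟨y, h.isExtreme.extremePoints_subset_extremePoints hy, fun v hv => ?_⟩
  have := hy.1.2 v hv
  simpa [l, real_inner_comm] using this

/-- The cones spanned by the tight constraints at the extreme points cover the space. -/
lemma exists_extremePoint_mem_cone [FiniteDimensional ℝ E] [Fintype ι] {w : ι → E} {h : ι → ℝ}
    (hg : IsGeneric w h) (hw : (0 : E) ∈ interior (convexHull ℝ (Set.range w)))
    (hne : (polyhedron w h).Nonempty) (x : E) :
    ∃ y ∈ (polyhedron w h).extremePoints ℝ, ∃ l : ι → ℝ,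
      (∀ i, 0 ≤ l i) ∧ (∀ i, l i ≠ 0 → i ∈ tightSet w h y) ∧ ∑ i, l i • w i = x := by
  classical
  obtain ⟨y, hy, hmax⟩ := exists_extremePoint_isMaxOn (isCompact_polyhedron h hw) hne x
  refine ⟨y, hy, ?_⟩
  let B : Basis (tightSet w h y) ℝ E := Basis.mk (hg y).linearIndependent (by
    have h2 : Set.range (fun i : tightSet w h y => w i) = w '' tightSet w h y := by
      ext; simp
    rw [h2, span_tightSet_eq_top hy])
  have hB : ∀ i, B i = w i := fun i => by simp [B]
  refine ⟨fun i => if hi : i ∈ tightSet w h y then B.repr x ⟨i, hi⟩ else 0, ?_, ?_, ?_⟩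
  · intro i
    dsimp only
    split_ifs with hi
    swap
    · exact le_rfl
    by_contra hneg
    push Not at hneg
    -- The vector `d` is minus the dual basis vector of `w i`: moving along it relaxes only the
    -- `i`-th tight constraint. If the `i`-th coefficient of `x` were negative, this move would
    -- increase the maximised functional.
    let f : E →L[ℝ] ℝ := LinearMap.toContinuousLinearMap (B.coord ⟨i, hi⟩)
    let d : E := -(InnerProductSpace.toDual ℝ E).symm f
    have hd : ∀ v, ⟪d, v⟫ = -B.coord ⟨i, hi⟩ v := fun v => by
      simp [d, f, inner_neg_left, InnerProductSpace.toDual_symm_apply]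
    obtain ⟨ε, hε, h1⟩ := exists_add_smul_mem_polyhedron (d := d) hy.1 (fun j hj => by
      rw [hd, ← hB ⟨j, hj⟩, Basis.coord_apply, Basis.repr_self, Finsupp.single_apply]
      split_ifs <;> norm_num)
    have h2 := hmax _ h1
    rw [inner_add_left, real_inner_smul_left, hd, Basis.coord_apply] at h2
    have := mul_pos hε (neg_pos.2 hneg)
    linarith
  · intro i hi
    by_contra h0
    simp [h0] at hi
  · conv_rhs => rw [← B.sum_repr x]
    refine (Fintype.sum_of_injective Subtype.val Subtype.val_injective _ _ ?_ ?_).symm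
    · intro i hi
      have : i ∉ tightSet w h y := by simpa using hi
      simp [this]
    · intro i
      simp [hB, i.2]

/-- If some point of the polyhedron satisfies only the `i`-th inequality with equality, then
at least `dim E` extreme points satisfy it with equality. -/
lemma finrank_le_ncard_extremePoints [FiniteDimensional ℝ E] [Finite ι] {w : ι → E} {h : ι → ℝ}
    (hw : (0 : E) ∈ interior (convexHull ℝ (Set.range w))) {i : ι} {y₀ : E}
    (hi : ⟪y₀, w i⟫ = h i) (hlt : ∀ j, j ≠ i → ⟪y₀, w j⟫ < h j) :
    finrank ℝ E ≤ {y ∈ (polyhedron w h).extremePoints ℝ | i ∈ tightSet w h y}.ncard := by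
  classical
  have hy₀ : y₀ ∈ polyhedron w h := fun j => by
    rcases eq_or_ne j i with rfl | hj
    exacts [hi.le, (hlt j hj).le]
  set Q := {y ∈ polyhedron w h | ⟪y, w i⟫ = h i} with hQ
  have hQc : IsCompact Q := by
    refine (isCompact_polyhedron h hw).inter_right ?_
    exact isClosed_eq (f := fun y : E => ⟪y, w i⟫) (by fun_prop) continuous_const
  have hQconv : Convex ℝ Q := by
    refine (convex_polyhedron w h).inter ?_
    exact convex_hyperplane (f := fun y : E => ⟪y, w i⟫)
      ⟨fun a b => inner_add_left _ _ _, fun a b => by simp [real_inner_smul_left]⟩ _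
  -- `Q` is a face, so it suffices to find enough extreme points of `Q` itself.
  have hext : Q.extremePoints ℝ ⊆ {y ∈ (polyhedron w h).extremePoints ℝ | i ∈ tightSet w h y} := by
    intro y hy
    refine ⟨⟨hy.1.1, fun a ha b hb hab => ?_⟩, hy.1.2⟩
    obtain ⟨s, t, hs, ht, hst, rfl⟩ := hab
    have h1 : s * ⟪a, w i⟫ + t * ⟪b, w i⟫ = h i := by
      have := hy.1.2
      rwa [inner_add_left, real_inner_smul_left, real_inner_smul_left] at this
    have h2 := ha i
    have h3 := hb i
    have h4 : ⟪a, w i⟫ = h i := by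
      refine le_antisymm h2 ?_
      have h5 : s * h i + t * h i = h i := by rw [← add_mul, hst, one_mul]
      have h6 := mul_le_mul_of_nonneg_left h3 ht.le
      exact le_of_mul_le_mul_left (by linarith) hs
    have h4' : ⟪b, w i⟫ = h i := by
      have h5 : s * h i + t * h i = h i := by rw [← add_mul, hst, one_mul]
      rw [h4] at h1
      exact mul_left_cancel₀ ht.ne' (by linarith)
    exact hy.2 ⟨ha, h4⟩ ⟨hb, h4'⟩ ⟨s, t, hs, ht, hst, rfl⟩
  have hfin : {y ∈ (polyhedron w h).extremePoints ℝ | i ∈ tightSet w h y}.Finite :=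
    (finite_extremePoints_polyhedron w h).subset fun y hy => hy.1
  refine le_trans ?_ (Set.ncard_le_ncard hext hfin)
  by_contra! hcard
  have hXfin := hfin.subset hext
  set X := hXfin.toFinset with hX
  have hXc : X.card < finrank ℝ E := by rwa [Set.ncard_eq_toFinset_card _ hXfin] at hcard
  obtain ⟨x₀, hx₀⟩ := hQc.extremePoints_nonempty ⟨y₀, hy₀, hi⟩
  have hx₀X : x₀ ∈ X := hXfin.mem_toFinset.2 hx₀
  -- With too few extreme points, some `d ≠ 0` is orthogonal to `w i` and to all their differences.
  -- By Krein-Milman `⟪d, ·⟫` is constant on `Q`; but only the `i`-th constraint is tight at `y₀`,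
  -- so a step along `d` stays in `Q`.
  let U : Submodule ℝ E :=
    Submodule.span ℝ ((insert (w i) ((X.erase x₀).image (fun x => x - x₀)) : Finset E) : Set E)
  have hU : finrank ℝ U < finrank ℝ E := by
    refine lt_of_le_of_lt (finrank_span_finset_le_card _) (lt_of_le_of_lt ?_ hXc)
    refine (Finset.card_insert_le _ _).trans ?_
    have h1 : ((X.erase x₀).image (fun x => x - x₀)).card ≤ X.card - 1 := by
      refine Finset.card_image_le.trans ?_
      rw [Finset.card_erase_of_mem hx₀X]
    have h2 : 0 < X.card := Finset.card_pos.2 ⟨_, hx₀X⟩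
    omega
  have hUt : Uᗮ ≠ ⊥ := by
    intro hb
    rw [Submodule.orthogonal_eq_bot_iff] at hb
    rw [hb, finrank_top] at hU
    exact lt_irrefl _ hU
  obtain ⟨d, hdU, hd0⟩ := Submodule.exists_mem_ne_zero_of_ne_bot hUt
  have hdi : ⟪d, w i⟫ = 0 := by
    rw [real_inner_comm]
    exact (Submodule.mem_orthogonal _ _).1 hdU _ (Submodule.subset_span (by simp))
  have hdX : ∀ x ∈ X, ⟪d, x⟫ = ⟪d, x₀⟫ := by
    intro x hx
    rcases eq_or_ne x x₀ with rfl | hne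
    · rfl
    rw [← sub_eq_zero, ← inner_sub_right, real_inner_comm]
    refine (Submodule.mem_orthogonal _ _).1 hdU _ (Submodule.subset_span ?_)
    simp only [Finset.coe_insert, Finset.coe_image, Finset.coe_erase]
    exact Set.mem_insert_of_mem _ ⟨x, ⟨hx, hne⟩, rfl⟩
  have hconst : ∀ y ∈ Q, ⟪d, y⟫ = ⟪d, x₀⟫ := by
    have hclosed : IsClosed {y : E | ⟪d, y⟫ = ⟪d, x₀⟫} :=
      isClosed_eq (by fun_prop) continuous_const
    have hcv : Convex ℝ {y : E | ⟪d, y⟫ = ⟪d, x₀⟫} :=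
      convex_hyperplane (f := fun y : E => ⟪d, y⟫)
        ⟨fun a b => inner_add_right _ _ _, fun a b => by simp [real_inner_smul_right]⟩ _
    intro y hy
    rw [← closure_convexHull_extremePoints hQc hQconv] at hy
    exact closure_minimal (convexHull_min
      (fun x hx => hdX x (hXfin.mem_toFinset.2 hx)) hcv) hclosed hy
  obtain ⟨ε, hε, h1⟩ := exists_add_smul_mem_polyhedron (d := d) hy₀ (fun j hj => by
    rcases eq_or_ne j i with rfl | hne
    · exact hdi.le
    · exact absurd hj (hlt j hne).ne)
  have h2 := hconst _ ⟨h1, by rw [inner_add_left, real_inner_smul_left, hdi, hi]; simp⟩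
  rw [inner_add_right, hconst y₀ ⟨hy₀, hi⟩, real_inner_smul_right] at h2
  have h3 : ε * ⟪d, d⟫ = 0 := by linarith
  rcases mul_eq_zero.1 h3 with h4 | h4
  · exact hε.ne' h4
  · exact hd0 (inner_self_eq_zero.1 h4)

/-- Each open nonempty set of right-hand sides contains a generic one. -/
lemma exists_isGeneric [Fintype ι] (w : ι → E) {U : Set (ι → ℝ)} (hU : IsOpen U)
    (hne : U.Nonempty) : ∃ h ∈ U, IsGeneric w h := by
  classical
  have hrel : ∀ T : Finset ι, ¬ LinearIndepOn ℝ w (T : Set ι) →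
      ∃ κ : ι → ℝ, ∑ i ∈ T, κ i • w i = 0 ∧ ∃ i ∈ T, κ i ≠ 0 := by
    intro T hT
    rw [linearIndepOn_finset_iff] at hT
    push Not at hT
    exact hT
  choose! κ hκ hκ0 using hrel
  -- If all constraints of a dependent `T` are tight at one point, pairing that point with the
  -- relation `κ T` gives `∑ κ T i * h i = 0`. This confines `h` to one of finitely many
  -- hyperplanes.
  have hae : ∀ᵐ h : ι → ℝ, ∀ T : Finset ι, ¬ LinearIndepOn ℝ w (T : Set ι) →
      ∑ i ∈ T, κ T i * h i ≠ 0 := by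
    rw [ae_all_iff]
    intro T
    by_cases hT : LinearIndepOn ℝ w (T : Set ι)
    · simp [hT]
    let f : (ι → ℝ) →ₗ[ℝ] ℝ := ∑ i ∈ T, κ T i • LinearMap.proj i
    have hf : ∀ h, f h = ∑ i ∈ T, κ T i * h i := fun h => by simp [f]
    have hker : LinearMap.ker f ≠ ⊤ := by
      obtain ⟨i, hiT, hi⟩ := hκ0 T hT
      intro htop
      have : Pi.single i 1 ∈ LinearMap.ker f := htop ▸ Submodule.mem_top
      rw [LinearMap.mem_ker, hf] at this
      simp [Pi.single_apply, hiT, hi] at this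
    have := Measure.addHaar_submodule (volume : Measure (ι → ℝ)) _ hker
    refine (measure_eq_zero_iff_ae_notMem.1 this).mono fun h hh _ h0 => hh ?_
    rw [SetLike.mem_coe, LinearMap.mem_ker, hf, h0]
  obtain ⟨h, hhU, hh⟩ := (Measure.dense_of_ae hae).inter_open_nonempty U hU hne
  refine ⟨h, hhU, fun y => ?_⟩
  by_contra hdep
  have hT : ¬ LinearIndepOn ℝ w ((tightSet w h y).toFinset : Set ι) := by simpa using hdep
  refine hh _ hT ?_
  have h1 : ∀ i ∈ (tightSet w h y).toFinset,
      κ (tightSet w h y).toFinset i * h i = ⟪y, κ (tightSet w h y).toFinset i • w i⟫ := by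
    intro i hi
    rw [real_inner_smul_right, show ⟪y, w i⟫ = h i from (Set.mem_toFinset (s := tightSet w h y)).1 hi]
  rw [Finset.sum_congr rfl h1, ← inner_sum, hκ _ hT, inner_zero_right]

/-- For right-hand sides near `1`, the tight constraints at an extreme point are also tight at
a point of `polyhedron w 1`. -/
lemma eventually_sum_le_one [Fintype ι] (w : ι → E) :
    ∀ᶠ h in nhds (1 : ι → ℝ), ∀ T : Finset ι, LinearIndepOn ℝ w (T : Set ι) →
      ∀ j, ∀ κ : ι → ℝ, ∑ i ∈ T, κ i • w i = w j → ∑ i ∈ T, κ i * h i ≤ h j →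
        ∑ i ∈ T, κ i ≤ 1 := by
  classical
  refine Filter.eventually_all.2 fun T => ?_
  by_cases hT : LinearIndepOn ℝ w (T : Set ι)
  swap
  · exact Filter.Eventually.of_forall fun h h' => absurd h' hT
  suffices ∀ᶠ h in nhds (1 : ι → ℝ), ∀ j, ∀ κ : ι → ℝ, ∑ i ∈ T, κ i • w i = w j →
      ∑ i ∈ T, κ i * h i ≤ h j → ∑ i ∈ T, κ i ≤ 1 from this.mono fun h hh _ => hh
  refine Filter.eventually_all.2 fun j => ?_
  by_cases hex : ∃ κ : ι → ℝ, ∑ i ∈ T, κ i • w i = w j ∧ 1 < ∑ i ∈ T, κ i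
  swap
  · push Not at hex
    exact Filter.Eventually.of_forall fun h κ hκ _ => hex κ hκ
  -- By independence `κ` is the only coefficient vector on `T`, and `∑ κ i > 1` violates the
  -- inequality for `h = 1` strictly, hence also for nearby `h`.
  obtain ⟨κ, hκ, hlt⟩ := hex
  have hc : Continuous fun h : ι → ℝ => ∑ i ∈ T, κ i * h i - h j := by fun_prop
  have h0 : 0 < ∑ i ∈ T, κ i * (1 : ι → ℝ) i - (1 : ι → ℝ) j := by simpa using hlt
  filter_upwards [(hc.tendsto 1).eventually (lt_mem_nhds h0)] with h hh κ' hκ' hle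
  have heq : ∀ i ∈ T, κ' i = κ i := by
    intro i hi
    have := (linearIndepOn_finset_iff.1 hT) (fun i => κ' i - κ i)
      (by simp only [sub_smul, Finset.sum_sub_distrib]; rw [hκ, hκ', sub_self]) i hi
    exact sub_eq_zero.1 this
  rw [Finset.sum_congr rfl fun i hi => by rw [heq i hi]] at hle
  exact absurd hle (not_le.2 (sub_pos.1 hh))

/-- Near `1`, there is an open set of right-hand sides for which no inequality is redundant. -/
lemma exists_open_irredundant [Fintype ι] {w : ι → E} (hw0 : ∀ i, w i ≠ 0)
    (hray : ∀ i j, SameRay ℝ (w i) (w j) → i = j)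
    (hsupp : ∀ i, ∃ y : E, ⟪y, w i⟫ = 1 ∧ ∀ j, ⟪y, w j⟫ ≤ 1)
    {U : Set (ι → ℝ)} (hU : U ∈ nhds (1 : ι → ℝ)) :
    ∃ V ⊆ U, IsOpen V ∧ V.Nonempty ∧ ∀ h ∈ V, ∀ i, ∃ y₀ : E,
      ⟪y₀, w i⟫ = h i ∧ ∀ j, j ≠ i → ⟪y₀, w j⟫ < h j := by
  have hcont : Continuous fun ε : ℝ => (fun i => 1 + ε * ‖w i‖ : ι → ℝ) := by fun_prop
  have h0 : (fun i => 1 + (0 : ℝ) * ‖w i‖ : ι → ℝ) = 1 := by ext; simp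
  have hev : ∀ᶠ ε in nhdsWithin (0 : ℝ) (Set.Ioi 0), (fun i => 1 + ε * ‖w i‖ : ι → ℝ) ∈ interior U :=
    nhdsWithin_le_nhds ((hcont.tendsto 0).eventually (by
      rw [h0]; exact interior_mem_nhds.2 hU))
  obtain ⟨ε, hεU, hε⟩ := (hev.and self_mem_nhdsWithin).exists
  choose y hy hy1 using hsupp
  have hε : 0 < ε := hε
  -- At the centre `h j = 1 + ε * ‖w j‖` this is `y i` pushed by `ε` in the direction of `w i`;
  -- strict Cauchy-Schwarz for distinct rays leaves all other constraints slack. The last term keeps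
  -- constraint `i` tight for every other `h`.
  let g : ι → (ι → ℝ) → E := fun i h =>
    y i + (ε * ‖w i‖⁻¹) • w i + ((h i - (1 + ε * ‖w i‖)) / ‖w i‖ ^ 2) • w i
  have hg : ∀ i, Continuous (g i) := fun i => by fun_prop
  have hgi : ∀ i h, ⟪g i h, w i⟫ = h i := by
    intro i h
    have hn : ‖w i‖ ≠ 0 := norm_ne_zero_iff.2 (hw0 i)
    simp only [g, inner_add_left, real_inner_smul_left, hy, real_inner_self_eq_norm_sq]
    field_simp
    ring
  let V : Set (ι → ℝ) := interior U ∩ ⋂ i, ⋂ j, {h | j ≠ i → ⟪g i h, w j⟫ < h j}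
  refine ⟨V, fun h hh => interior_subset hh.1, ?_, ⟨fun i => 1 + ε * ‖w i‖, hεU, ?_⟩, ?_⟩
  · refine isOpen_interior.inter (isOpen_iInter_of_finite fun i => isOpen_iInter_of_finite fun j => ?_)
    by_cases hij : j = i
    · simp [hij]
    · simp only [ne_eq, hij, not_false_eq_true, true_imp_iff]
      have := hg i
      exact isOpen_lt (by fun_prop) (by fun_prop)
  · simp only [Set.mem_iInter]
    intro i j hij
    have hn : 0 < ‖w i‖ := norm_pos_iff.2 (hw0 i)
    have hlt : ⟪w i, w j⟫ < ‖w i‖ * ‖w j‖ := by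
      refine lt_of_le_of_ne (real_inner_le_norm _ _) fun heq => hij ?_
      exact (hray i j ((inner_eq_norm_mul_iff_real.1 heq) |> fun e => by
        rw [sameRay_iff_norm_smul_eq]; exact e.symm)).symm
    have h1 := hy1 i j
    have h2 : ε * ‖w i‖⁻¹ * ⟪w i, w j⟫ < ε * ‖w j‖ := by
      rw [mul_assoc]
      refine mul_lt_mul_of_pos_left ?_ hε
      rw [inv_mul_lt_iff₀ hn]
      exact hlt
    simp only [g, inner_add_left, real_inner_smul_left, sub_self, zero_div, zero_mul, add_zero]
    change _ < 1 + ε * ‖w j‖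
    linarith
  · intro h hh i
    refine ⟨g i h, hgi i h, fun j hij => ?_⟩
    have := hh.2
    simp only [Set.mem_iInter] at this
    exact this i j hij

end Polar

/-! ### Triangulating the boundary of a polytope. -/

section Triangulation

variable {E : Type*} [NormedAddCommGroup E] [InnerProductSpace ℝ E]

lemma add_smul_mem_interior_of_lt_one {K : Set E} (hK : Convex ℝ K) {q : E} (hq : q ∈ interior K)
    {x : E} {r : ℝ} (hr : 0 ≤ r) (hr1 : r < 1) (hx : q + x ∈ K) : q + r • x ∈ interior K := by
  have := hK.combo_interior_self_mem_interior hq hx (sub_pos.2 hr1) hr (by ring)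
  convert this using 1
  module

/-- By Krein-Milman the extreme points suffice; they belong to `S` and are never interior. -/
lemma convexHull_inter_frontier [Nontrivial E] {S : Set E} (hS : S.Finite) :
    convexHull ℝ (S ∩ frontier (convexHull ℝ S)) = convexHull ℝ S := by
  refine Set.Subset.antisymm (convexHull_mono Set.inter_subset_left) ?_
  have hc := hS.isCompact_convexHull ℝ
  conv_lhs => rw [← closure_convexHull_extremePoints hc (convex_convexHull ℝ S)]
  refine closure_minimal (convexHull_mono fun x hx => ⟨extremePoints_convexHull_subset hx, ?_⟩)
    (((hS.subset Set.inter_subset_left).isCompact_convexHull ℝ).isClosed)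
  rw [hc.isClosed.frontier_eq]
  exact ⟨extremePoints_subset hx, fun hi =>
    Set.disjoint_left.1 (disjoint_interior_extremePoints _) hi hx⟩

variable [FiniteDimensional ℝ E]

/-- The supporting hyperplane theorem, normalised at an interior point. -/
lemma exists_supporting_functional {K : Set E} (hK : Convex ℝ K) {q x : E} (hq : q ∈ interior K)
    (hx : x ∈ frontier K) : ∃ y : E, ⟪y, x - q⟫ = 1 ∧ ∀ p ∈ K, ⟪y, p - q⟫ ≤ 1 := by
  obtain ⟨f, hf⟩ := geometric_hahn_banach_open_point hK.interior isOpen_interior hx.2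
  have hpos : 0 < f x - f q := sub_pos.2 (hf q hq)
  have hle : ∀ p ∈ K, f p ≤ f x := by
    intro p hp
    have h1 : p ∈ closure (interior K) := by
      rw [hK.closure_interior_eq_closure_of_nonempty_interior ⟨q, hq⟩]
      exact subset_closure hp
    exact closure_minimal (fun z hz => (hf z hz).le)
      (isClosed_le f.continuous continuous_const) h1
  refine ⟨(f x - f q)⁻¹ • (InnerProductSpace.toDual ℝ E).symm f, ?_, fun p hp => ?_⟩
  · rw [real_inner_smul_left, InnerProductSpace.toDual_symm_apply, map_sub,
      inv_mul_cancel₀ hpos.ne']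
  · rw [real_inner_smul_left, InnerProductSpace.toDual_symm_apply, map_sub, inv_mul_le_iff₀ hpos,
      mul_one]
    exact sub_le_sub_right (hle p hp) _

/-- The boundary of a polytope can be triangulated by simplices with vertices in a prescribed
finite set of points, using all of these points which are in the boundary. There are at least
as many simplices as vertices. -/
theorem exists_boundary_triangulation {d : ℕ} (hd : finrank ℝ E = d + 1) {S : Set E}
    (hS : S.Finite) {q : E} (hq : q ∈ interior (convexHull ℝ S)) :
    ∃ (N : ℕ) (a : Fin N → Fin (d + 1) → E) (y : Fin N → E),
      (∀ k i, a k i ∈ S) ∧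
      (∀ k, LinearIndependent ℝ (fun i => a k i - q)) ∧
      (∀ k i, ⟪y k, a k i - q⟫ = 1) ∧ (∀ k, ∀ p ∈ convexHull ℝ S, ⟪y k, p - q⟫ ≤ 1) ∧
      (∀ k k' (l m : Fin (d + 1) → ℝ), (∀ i, 0 < l i) → (∀ i, 0 ≤ m i) →
        ∑ i, l i • (a k i - q) = ∑ i, m i • (a k' i - q) → k' = k) ∧
      (∀ x ∈ frontier (convexHull ℝ S), ∃ k, ∃ l : Fin (d + 1) → ℝ,
        (∀ i, 0 ≤ l i) ∧ ∑ i, l i = 1 ∧ ∑ i, l i • a k i = x) ∧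
      (S ∩ frontier (convexHull ℝ S)).ncard ≤ N := by
  classical
  have : Nontrivial E := Module.nontrivial_of_finrank_pos (R := ℝ) (by omega)
  set P := convexHull ℝ S with hP
  have hPconv : Convex ℝ P := convex_convexHull ℝ S
  have hPclosed : IsClosed P := (hS.isCompact_convexHull ℝ).isClosed
  have hfin : (S ∩ frontier P).Finite := hS.subset Set.inter_subset_left
  have : Fintype ↥(S ∩ frontier P) := hfin.fintype
  let w : ↥(S ∩ frontier P) → E := fun i => i - q
  have hwrange : convexHull ℝ (Set.range w) = (fun x => x - q) '' P := by
    have h1 : Set.range w = (AffineMap.id ℝ E - AffineMap.const ℝ E q) '' (S ∩ frontier P) := by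
      ext x; simp [w]
    rw [h1, ← AffineMap.image_convexHull, convexHull_inter_frontier hS]
    ext x; simp [hP]
  have hw : (0 : E) ∈ interior (convexHull ℝ (Set.range w)) := by
    rw [hwrange]
    have := (Homeomorph.subRight q).image_interior P
    simp only [Homeomorph.coe_subRight] at this
    rw [← this]
    exact ⟨q, hq, sub_self q⟩
  have hsupp : ∀ i, ∃ y : E, ⟪y, w i⟫ = 1 ∧ ∀ j, ⟪y, w j⟫ ≤ 1 := fun i => by
    obtain ⟨y, h1, h2⟩ := exists_supporting_functional hPconv hq i.2.2
    exact ⟨y, h1, fun j => h2 _ (subset_convexHull ℝ S j.2.1)⟩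
  have hw0 : ∀ i, w i ≠ 0 := fun i h0 => by
    obtain ⟨y, h1, -⟩ := hsupp i
    simp [h0] at h1
  -- Each ray from the interior point `q` meets the boundary once.
  have hray : ∀ i j, SameRay ℝ (w i) (w j) → i = j := by
    intro i j hij
    obtain ⟨r, hr, hrw⟩ := hij.exists_pos_left (hw0 i) (hw0 j)
    obtain ⟨y, h1, h2⟩ := hsupp i
    obtain ⟨y', h1', h2'⟩ := hsupp j
    have e1 := h2 j
    rw [← hrw, real_inner_smul_right, h1] at e1
    have e2 := h2' i
    have e3 := h1'
    rw [← hrw, real_inner_smul_right] at e3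
    have : r = 1 := by
      refine le_antisymm (by linarith) ?_
      nlinarith
    rw [this, one_smul] at hrw
    exact Subtype.ext (sub_left_injective hrw)
  obtain ⟨V, hVU, hVo, hVne, hV⟩ :=
    exists_open_irredundant hw0 hray hsupp (eventually_sum_le_one w)
  obtain ⟨h, hhV, hgen⟩ := exists_isGeneric w hVo hVne
  have hone := hVU hhV
  have hirr := hV h hhV
  set X := (polyhedron w h).extremePoints ℝ with hX
  have hXfin : X.Finite := finite_extremePoints_polyhedron w h
  obtain ⟨i₀⟩ : Nonempty ↥(S ∩ frontier P) := by
    by_contra hemp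
    rw [not_nonempty_iff] at hemp
    rw [Set.range_eq_empty] at hw
    simp at hw
  have hne : (polyhedron w h).Nonempty := by
    obtain ⟨y₀, h1, h2⟩ := hirr i₀
    refine ⟨y₀, fun j => ?_⟩
    rcases eq_or_ne j i₀ with rfl | hj
    exacts [h1.le, (h2 j hj).le]
  let N := Fintype.card hXfin.toFinset
  let e : Fin N ≃ hXfin.toFinset := (Fintype.equivFin _).symm
  have heX : ∀ k, (e k : E) ∈ X := fun k => hXfin.mem_toFinset.1 (e k).2
  have hesurj : ∀ z ∈ X, ∃ k, (e k : E) = z := fun z hz =>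
    ⟨e.symm ⟨z, hXfin.mem_toFinset.2 hz⟩, by simp⟩
  have henum : ∀ k, ∃ b : Fin (d + 1) → ↥(S ∩ frontier P),
      Function.Injective b ∧ Set.range b = tightSet w h (e k) := by
    intro k
    have hc := ncard_tightSet hgen (heX k)
    rw [hd, ← Nat.card_coe_set_eq] at hc
    let f := (Finite.equivFinOfCardEq hc).symm
    refine ⟨fun i => f i, Subtype.val_injective.comp f.injective, ?_⟩
    ext x
    constructor
    · rintro ⟨i, rfl⟩; exact (f i).2
    · intro hx; exact ⟨f.symm ⟨x, hx⟩, by simp⟩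
  choose b hbinj hbrange using henum
  have hli : ∀ k, LinearIndependent ℝ (fun i => w (b k i)) := by
    intro k
    have h1 := hgen (e k)
    rw [← hbrange k] at h1
    have h2 := h1.linearIndependent
    exact (h2.comp (fun i => ⟨b k i, i, rfl⟩) fun i j hij => hbinj k (congrArg Subtype.val hij))
  have hspan : ∀ k, ∃ y : E, ∀ i, ⟪y, w (b k i)⟫ = 1 := by
    intro k
    let B := basisOfLinearIndependentOfCardEqFinrank (hli k) (by simp [hd])
    let f : E →L[ℝ] ℝ := LinearMap.toContinuousLinearMap (B.constr ℝ fun _ => (1 : ℝ))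
    refine ⟨(InnerProductSpace.toDual ℝ E).symm f, fun i => ?_⟩
    rw [InnerProductSpace.toDual_symm_apply]
    have : w (b k i) = B i := by simp [B]
    rw [this]
    simp [f]
  choose y hy using hspan
  -- Expand `w j` in the normals tight at the vertex `e k`. Feasibility of the vertex for `h` is the
  -- inequality required by `hone`, which bounds the sum of the coefficients, namely `⟪y k, w j⟫`,
  -- by `1`.
  have hyle : ∀ k, ∀ j, ⟪y k, w j⟫ ≤ 1 := by
    intro k j
    let B := basisOfLinearIndependentOfCardEqFinrank (hli k) (by simp [hd])
    have hB : ∀ i, B i = w (b k i) := fun i => by simp [B]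
    have hLI : LinearIndepOn ℝ w ((Finset.univ.image (b k) : Finset _) : Set _) := by
      simpa [hbrange k] using hgen (e k)
    let κ : ↥(S ∩ frontier P) → ℝ := fun j' =>
      if hj : ∃ i, b k i = j' then B.repr (w j) hj.choose else 0
    have hκ : ∀ i, κ (b k i) = B.repr (w j) i := fun i => by
      have hex : ∃ i', b k i' = b k i := ⟨i, rfl⟩
      have : hex.choose = i := hbinj k hex.choose_spec
      simp only [κ, hex, dif_pos]
      rw [this]
    have hsum : ∑ i, B.repr (w j) i • w (b k i) = w j := by
      conv_rhs => rw [← B.sum_repr (w j)]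
      exact Finset.sum_congr rfl fun i _ => by rw [hB]
    have h1 := hone (Finset.univ.image (b k)) hLI j κ (by
      rw [Finset.sum_image (hbinj k).injOn]
      simp only [hκ, hsum]) (by
      rw [Finset.sum_image (hbinj k).injOn]
      have h2 : ∀ i, κ (b k i) * h (b k i) = ⟪(e k : E), B.repr (w j) i • w (b k i)⟫ := fun i => by
        rw [real_inner_smul_right, hκ, show ⟪(e k : E), w (b k i)⟫ = h (b k i) from
          (hbrange k).subset ⟨i, rfl⟩]
      rw [Finset.sum_congr rfl fun i _ => h2 i, ← inner_sum, hsum]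
      exact (heX k).1 j)
    rw [Finset.sum_image (hbinj k).injOn] at h1
    rw [← hsum, inner_sum]
    refine le_of_eq_of_le (Finset.sum_congr rfl fun i _ => ?_) h1
    rw [real_inner_smul_right, hy, mul_one, hκ]
  have hyP : ∀ k, ∀ p ∈ P, ⟪y k, p - q⟫ ≤ 1 := fun k p hp =>
    inner_le_of_mem_convexHull (hyle k) (by rw [hwrange]; exact ⟨p, hp, rfl⟩)
  refine ⟨N, fun k i => b k i, y, fun k i => (b k i).2.1, hli, hy, hyP, ?_, ?_, ?_⟩
  · intro k k' l m hl hm heq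
    have := extremePoint_unique (heX k) (heX k') (hbrange k) (hbrange k') hl hm heq rfl
    exact e.injective (Subtype.ext this)
  · intro x hx
    obtain ⟨z, hz, l, hl0, hlt, hlx⟩ := exists_extremePoint_mem_cone hgen hw hne (x - q)
    obtain ⟨k, rfl⟩ := hesurj z hz
    have hsum : ∑ i, l (b k i) • w (b k i) = x - q := by
      rw [← hlx]
      refine Fintype.sum_of_injective (b k) (hbinj k) _ _ (fun j hj => ?_) fun i => rfl
      have : l j = 0 := by
        by_contra h0
        exact hj ((hbrange k).symm.subset (hlt j h0))
      rw [this, zero_smul]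
    have hxP : x ∈ P := hPclosed.frontier_subset hx
    have hs : ∑ i, l (b k i) = ⟪y k, x - q⟫ := by
      rw [← hsum, inner_sum]
      exact Finset.sum_congr rfl fun i _ => by rw [real_inner_smul_right, hy, mul_one]
    -- If the sum were less than `1`, `x` would be `q` or a contraction towards `q` of a point of
    -- `P`, hence interior.
    have hs1 : ∑ i, l (b k i) = 1 := by
      refine le_antisymm (hs ▸ hyP k x hxP) ?_
      by_contra! hlt1
      refine hx.2 ?_
      have hmem : ∀ r : ℝ, ∑ i, l (b k i) = r → 0 < r →
          q + r⁻¹ • (x - q) ∈ P := by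
        intro r hr hrpos
        have h1 : q + r⁻¹ • (x - q) = ∑ i, (r⁻¹ * l (b k i)) • (b k i : E) := by
          have h2 : ∑ i, (r⁻¹ * l (b k i)) • (b k i : E) =
              ∑ i, (r⁻¹ * l (b k i)) • w (b k i) + (∑ i, r⁻¹ * l (b k i)) • q := by
            rw [Finset.sum_smul, ← Finset.sum_add_distrib]
            exact Finset.sum_congr rfl fun i _ => by simp only [w]; module
          rw [h2, ← Finset.mul_sum, hr, inv_mul_cancel₀ hrpos.ne', one_smul, add_comm, ← hsum,
            Finset.smul_sum]
          simp only [smul_smul]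
        rw [h1]
        refine hPconv.sum_mem (fun i _ => mul_nonneg (inv_nonneg.2 hrpos.le) (hl0 _)) ?_
          fun i _ => subset_convexHull ℝ S (b k i).2.1
        rw [← Finset.mul_sum, hr, inv_mul_cancel₀ hrpos.ne']
      have hnn : 0 ≤ ∑ i, l (b k i) := Finset.sum_nonneg fun i _ => hl0 _
      rcases hnn.eq_or_lt with h0 | hpos
      · have h1 : ∀ i, l (b k i) = 0 := fun i =>
          (Finset.sum_eq_zero_iff_of_nonneg fun i _ => hl0 (b k i)).1 h0.symm i (Finset.mem_univ i)
        simp only [h1, zero_smul, Finset.sum_const_zero] at hsum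
        rwa [← sub_eq_zero.1 hsum.symm] at hq
      · have := add_smul_mem_interior_of_lt_one hPconv hq hpos.le hlt1 (hmem _ rfl hpos)
        rw [smul_smul, mul_inv_cancel₀ hpos.ne', one_smul] at this
        simpa using this
    refine ⟨k, fun i => l (b k i), fun i => hl0 _, hs1, ?_⟩
    have h2 : ∑ i, l (b k i) • (b k i : E) =
        ∑ i, l (b k i) • w (b k i) + (∑ i, l (b k i)) • q := by
      rw [Finset.sum_smul, ← Finset.sum_add_distrib]
      exact Finset.sum_congr rfl fun i _ => by simp only [w]; module
    rw [h2, hsum, hs1]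
    simp
  · have hcount := Finset.sum_card_bipartiteAbove_eq_sum_card_bipartiteBelow
      (fun (i : ↥(S ∩ frontier P)) (z : E) => i ∈ tightSet w h z)
      (s := Finset.univ) (t := hXfin.toFinset)
    have hb1 : ∀ z ∈ hXfin.toFinset, (Finset.bipartiteBelow
        (fun (i : ↥(S ∩ frontier P)) (z : E) => i ∈ tightSet w h z) Finset.univ z).card
        = d + 1 := by
      intro z hz
      rw [← hd, ← ncard_tightSet hgen (hXfin.mem_toFinset.1 hz), Set.ncard_eq_toFinset_card']
      congr 1
      ext i; simp [Finset.bipartiteBelow]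
    have hb2 : ∀ i ∈ (Finset.univ : Finset ↥(S ∩ frontier P)), d + 1 ≤ (Finset.bipartiteAbove
        (fun (i : ↥(S ∩ frontier P)) (z : E) => i ∈ tightSet w h z) hXfin.toFinset i).card := by
      intro i _
      obtain ⟨y₀, h1, h2⟩ := hirr i
      have h3 := finrank_le_ncard_extremePoints hw h1 h2
      rw [hd] at h3
      refine h3.trans (le_of_eq ?_)
      rw [← Set.ncard_coe_finset]
      congr 1
      ext z; simp [Finset.bipartiteAbove, hX]
    rw [Finset.sum_congr rfl hb1, Finset.sum_const, smul_eq_mul] at hcount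
    have h4 := Finset.card_nsmul_le_sum _ _ _ hb2
    rw [hcount, smul_eq_mul] at h4
    have h5 := Nat.le_of_mul_le_mul_right h4 (Nat.succ_pos d)
    rw [← Nat.card_coe_set_eq, Nat.card_eq_fintype_card]
    have h6 : N = hXfin.toFinset.card := Fintype.card_coe _
    rw [h6]
    exact h5

end Triangulation

/-! ### Determinants, hyperplane forms and their integrality on a lattice. -/

section Lattice

variable {d : ℕ}

/-- The determinant with respect to the standard basis. -/
noncomputable def stdDet (n : ℕ) : EuclideanSpace ℝ (Fin n) [⋀^Fin n]→ₗ[ℝ] ℝ :=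
  (EuclideanSpace.basisFun (Fin n) ℝ).toBasis.det

lemma sq_stdDet {n : ℕ} (v : Fin n → EuclideanSpace ℝ (Fin n)) :
    stdDet n v ^ 2 = (Matrix.gram ℝ v).det := by
  rw [Matrix.gram_eq_conjTranspose_mul (EuclideanSpace.basisFun (Fin n) ℝ) v, Matrix.det_mul,
    Matrix.det_conjTranspose, star_trivial, ← sq]
  rfl

lemma abs_stdDet {n : ℕ} (v : Fin n → EuclideanSpace ℝ (Fin n)) :
    |stdDet n v| = √(Matrix.gram ℝ v).det := by
  rw [← sq_stdDet, Real.sqrt_sq_eq_abs]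

lemma covolume_eq_abs_stdDet {n : ℕ} (L : Submodule ℤ (EuclideanSpace ℝ (Fin n)))
    [DiscreteTopology L] [IsZLattice ℝ L] (B : Basis (Fin n) ℤ L) :
    ZLattice.covolume L = |stdDet n (fun i => (B i : EuclideanSpace ℝ (Fin n)))| := by
  rw [ZLattice.covolume_eq_det_mul_measureReal L volume B
    (EuclideanSpace.basisFun (Fin n) ℝ).toBasis]
  have : volume.real (ZSpan.fundamentalDomain (EuclideanSpace.basisFun (Fin n) ℝ).toBasis) = 1 := by
    rw [measureReal_def, measure_congr (ZSpan.fundamentalDomain_ae_parallelepiped _ _)]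
    have := (EuclideanSpace.basisFun (Fin n) ℝ).volume_parallelepiped
    simp only [OrthonormalBasis.coe_toBasis]
    rw [this]; simp
  rw [this, mul_one]
  rfl

/-- The linear form `x ↦ det (x, c₁, …, c_d)`. -/
noncomputable def hyperplaneForm (c : Fin d → EuclideanSpace ℝ (Fin (d + 1))) :
    EuclideanSpace ℝ (Fin (d + 1)) →ₗ[ℝ] ℝ where
  toFun x := stdDet (d + 1) (Fin.cons x c)
  map_add' x y := (stdDet (d + 1)).toMultilinearMap.cons_add c x y
  map_smul' r x := (stdDet (d + 1)).toMultilinearMap.cons_smul c r x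

lemma hyperplaneForm_apply (c : Fin d → EuclideanSpace ℝ (Fin (d + 1)))
    (x : EuclideanSpace ℝ (Fin (d + 1))) :
    hyperplaneForm c x = stdDet (d + 1) (Fin.cons x c) := rfl

lemma hyperplaneForm_self (c : Fin d → EuclideanSpace ℝ (Fin (d + 1))) (i : Fin d) :
    hyperplaneForm c (c i) = 0 :=
  (stdDet (d + 1)).map_eq_zero_of_eq (i := 0) (j := i.succ) _ (by simp) (Fin.succ_ne_zero i).symm

lemma hyperplaneForm_eq_zero_of_mem_span {c : Fin d → EuclideanSpace ℝ (Fin (d + 1))}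
    {x : EuclideanSpace ℝ (Fin (d + 1))} (hx : x ∈ Submodule.span ℝ (Set.range c)) :
    hyperplaneForm c x = 0 := by
  have : Submodule.span ℝ (Set.range c) ≤ LinearMap.ker (hyperplaneForm c) := by
    rw [Submodule.span_le]
    rintro _ ⟨i, rfl⟩
    exact hyperplaneForm_self c i
  exact this hx

lemma span_range_eq_orthogonal {c : Fin d → EuclideanSpace ℝ (Fin (d + 1))}
    (hc : LinearIndependent ℝ c) {v : EuclideanSpace ℝ (Fin (d + 1))} (hv : v ≠ 0)
    (hvc : ∀ i, ⟪v, c i⟫ = 0) : Submodule.span ℝ (Set.range c) = (ℝ ∙ v)ᗮ := by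
  refine Submodule.eq_of_le_of_finrank_eq ?_ ?_
  · rw [Submodule.span_le]
    rintro _ ⟨i, rfl⟩
    exact Submodule.mem_orthogonal_singleton_iff_inner_right.2 (hvc i)
  · rw [finrank_span_eq_card hc, Fintype.card_fin]
    have : Fact (finrank ℝ (EuclideanSpace ℝ (Fin (d + 1))) = d + 1) := ⟨by simp⟩
    exact (Submodule.finrank_orthogonal_span_singleton hv).symm

/-- The form vanishes on the span of `c`, the orthogonal complement of `v`, so it is a multiple of
`⟪v, ·⟫`. The factor is its value at `v`, where the Gram matrix of `(v, c)` is block diagonal. -/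
lemma abs_hyperplaneForm {c : Fin d → EuclideanSpace ℝ (Fin (d + 1))}
    (hc : LinearIndependent ℝ c) {v : EuclideanSpace ℝ (Fin (d + 1))} (hv : ‖v‖ = 1)
    (hvc : ∀ i, ⟪v, c i⟫ = 0) (x : EuclideanSpace ℝ (Fin (d + 1))) :
    |hyperplaneForm c x| = |⟪v, x⟫| * √(Matrix.gram ℝ c).det := by
  have hv0 : v ≠ 0 := by rintro rfl; simp at hv
  have h1 : |hyperplaneForm c v| = √(Matrix.gram ℝ c).det := by
    rw [hyperplaneForm_apply, abs_stdDet, Matrix.det_succ_row_zero, Fin.sum_univ_succ]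
    congr 1
    simp [Matrix.gram_apply, hvc, hv]
    rfl
  have h2 : hyperplaneForm c x = ⟪v, x⟫ * hyperplaneForm c v := by
    have h3 : x - ⟪v, x⟫ • v ∈ Submodule.span ℝ (Set.range c) := by
      rw [span_range_eq_orthogonal hc hv0 hvc, Submodule.mem_orthogonal_singleton_iff_inner_right,
        inner_sub_right, real_inner_smul_right, real_inner_self_eq_norm_sq, hv]
      ring
    have := hyperplaneForm_eq_zero_of_mem_span h3
    rw [map_sub, map_smul, sub_eq_zero] at this
    exact this
  rw [h2, abs_mul, h1]

lemma exists_unit_normal (c : Fin d → EuclideanSpace ℝ (Fin (d + 1))) :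
    ∃ v : EuclideanSpace ℝ (Fin (d + 1)), ‖v‖ = 1 ∧ ∀ i, ⟪v, c i⟫ = 0 := by
  have hne : (Submodule.span ℝ (Set.range c))ᗮ ≠ ⊥ := by
    intro hb
    rw [Submodule.orthogonal_eq_bot_iff] at hb
    have h1 := finrank_range_le_card (R := ℝ) c
    rw [Set.finrank, hb, finrank_top] at h1
    simp at h1
  obtain ⟨u, hu, hu0⟩ := Submodule.exists_mem_ne_zero_of_ne_bot hne
  refine ⟨(‖u‖⁻¹ : ℝ) • u, norm_smul_inv_norm hu0, fun i => ?_⟩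
  rw [real_inner_smul_left, real_inner_comm,
    (Submodule.mem_orthogonal _ _).1 hu _ (Submodule.subset_span ⟨i, rfl⟩), mul_zero]

lemma abs_hyperplaneForm_le {c : Fin d → EuclideanSpace ℝ (Fin (d + 1))}
    (hc : LinearIndependent ℝ c) (x : EuclideanSpace ℝ (Fin (d + 1))) :
    |hyperplaneForm c x| ≤ ‖x‖ * √(Matrix.gram ℝ c).det := by
  obtain ⟨v, hv, hvc⟩ := exists_unit_normal c
  rw [abs_hyperplaneForm hc hv hvc]
  refine mul_le_mul_of_nonneg_right ?_ (Real.sqrt_nonneg _)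
  simpa [hv] using abs_real_inner_le_norm v x

variable (L : Submodule ℤ (EuclideanSpace ℝ (Fin (d + 1)))) [DiscreteTopology L] [IsZLattice ℝ L]

lemma exists_zbasis : Nonempty (Basis (Fin (d + 1)) ℤ L) := by
  have : Module.Finite ℤ L := ZLattice.module_finite ℝ L
  have : Module.Free ℤ L := ZLattice.module_free ℝ L
  exact ⟨finBasisOfFinrankEq ℤ L (by rw [ZLattice.rank ℝ L]; simp)⟩

variable {L}

/-- A determinant of lattice vectors is an integral multiple of the covolume. -/
lemma stdDet_eq_mul_intDet (B : Basis (Fin (d + 1)) ℤ L) (v : Fin (d + 1) → L) :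
    stdDet (d + 1) (fun i => (v i : EuclideanSpace ℝ (Fin (d + 1)))) =
      stdDet (d + 1) (fun i => (B i : EuclideanSpace ℝ (Fin (d + 1)))) * (B.det v : ℝ) := by
  let b := B.ofZLatticeBasis ℝ L
  have hb : ⇑b = fun i => (B i : EuclideanSpace ℝ (Fin (d + 1))) := by
    ext1 i; exact B.ofZLatticeBasis_apply ℝ L i
  have h1 : stdDet (d + 1) = stdDet (d + 1) b • b.det := AlternatingMap.eq_smul_basis_det _ _
  conv_lhs => rw [h1]
  rw [AlternatingMap.smul_apply, smul_eq_mul, hb]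
  congr 1
  rw [Basis.det_apply, Basis.det_apply]
  have : (B.det v : ℝ) = (Int.castRingHom ℝ) (B.toMatrix v).det := by
    rw [Basis.det_apply]; rfl
  rw [← Basis.det_apply B, this, RingHom.map_det]
  congr 1
  ext i j
  simp only [Basis.toMatrix_apply, RingHom.mapMatrix_apply, Matrix.map_apply]
  exact B.ofZLatticeBasis_repr_apply ℝ L (v j) i

/-- The integral form `x ↦ det (x, c₁, …, c_d)` in coordinates with respect to a lattice basis. -/
noncomputable def intForm (B : Basis (Fin (d + 1)) ℤ L) (c : Fin d → L) : L →ₗ[ℤ] ℤ where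
  toFun x := B.det (Fin.cons x c)
  map_add' x y := B.det.toMultilinearMap.cons_add c x y
  map_smul' r x := B.det.toMultilinearMap.cons_smul c r x

lemma hyperplaneForm_eq_mul_intForm (B : Basis (Fin (d + 1)) ℤ L) (c : Fin d → L) (x : L) :
    hyperplaneForm (fun i => (c i : EuclideanSpace ℝ (Fin (d + 1)))) x =
      stdDet (d + 1) (fun i => (B i : EuclideanSpace ℝ (Fin (d + 1)))) * (intForm B c x : ℝ) := by
  have h := stdDet_eq_mul_intDet B (Fin.cons x c)
  have h2 : (fun i => ((Fin.cons x c : Fin (d + 1) → L) i : EuclideanSpace ℝ (Fin (d + 1)))) =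
      Fin.cons (x : EuclideanSpace ℝ (Fin (d + 1)))
        (fun i => (c i : EuclideanSpace ℝ (Fin (d + 1)))) := by
    ext1 i; refine Fin.cases ?_ (fun i => ?_) i <;> simp
  rw [h2] at h
  exact h

end Lattice

/-! ### Minimal hyperplane sublattices and shortest polar vectors. -/

section Minima

variable {d : ℕ} {L : Submodule ℤ (EuclideanSpace ℝ (Fin (d + 1)))} [DiscreteTopology L]

/-- For a discrete subgroup the rank over `ℤ` equals the dimension of the real span. -/
lemma linearIndependent_of_basis_sublattice {k : ℕ} {M : Submodule ℤ (EuclideanSpace ℝ (Fin (d + 1)))}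
    (hM : M ≤ L) (b : Basis (Fin k) ℤ M) :
    LinearIndependent ℝ (fun i => (b i : EuclideanSpace ℝ (Fin (d + 1)))) := by
  set v := fun i => (b i : EuclideanSpace ℝ (Fin (d + 1))) with hv
  have hZ : LinearIndependent ℤ v :=
    b.linearIndependent.map' M.subtype (Submodule.ker_subtype M)
  have hsp : Submodule.span ℤ (Set.range v) = M := by
    have : Set.range v = M.subtype '' Set.range b := by
      rw [← Set.range_comp]; rfl
    rw [this, Submodule.span_image, b.span_eq, Submodule.map_top, Submodule.range_subtype]
  have hdisc : DiscreteTopology (Submodule.span ℤ (Set.range v)) := by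
    rw [hsp]
    exact DiscreteTopology.of_subset (s := (L : Set _)) ‹_› hM
  have h1 := Real.finrank_eq_int_finrank_of_discrete hdisc
  rw [linearIndependent_iff_card_eq_finrank_span, h1, Set.finrank, finrank_span_eq_card hZ]

variable [IsZLattice ℝ L]

/-- The normal vector of a lattice hyperplane, as a vector of the polar lattice. -/
lemma exists_polar_norm_le {c : Fin d → L}
    (hc : LinearIndependent ℝ fun i => (c i : EuclideanSpace ℝ (Fin (d + 1)))) :
    ∃ y ∈ polarLattice L, y ≠ 0 ∧ ‖y‖ * ZLattice.covolume L ≤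
      √(Matrix.gram ℝ fun i => (c i : EuclideanSpace ℝ (Fin (d + 1)))).det := by
  set c' := fun i => (c i : EuclideanSpace ℝ (Fin (d + 1))) with hc'
  obtain ⟨B⟩ := exists_zbasis L
  have hpos := ZLattice.covolume_pos L
  set D := stdDet (d + 1) (fun i => (B i : EuclideanSpace ℝ (Fin (d + 1)))) with hD
  have hcov : ZLattice.covolume L = |D| := covolume_eq_abs_stdDet L B
  have hD0 : D ≠ 0 := by intro h; rw [hcov, h] at hpos; simp at hpos
  -- Dividing the form by the determinant of a lattice basis makes it integral on `L`, so its
  -- representing vector `y` is polar. Evaluating the form at `y` itself bounds the norm.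
  let f : EuclideanSpace ℝ (Fin (d + 1)) →L[ℝ] ℝ :=
    LinearMap.toContinuousLinearMap (D⁻¹ • hyperplaneForm c')
  set y := (InnerProductSpace.toDual ℝ (EuclideanSpace ℝ (Fin (d + 1)))).symm f with hy
  have hyx : ∀ x, ⟪y, x⟫ = D⁻¹ * hyperplaneForm c' x := fun x => by
    rw [hy, InnerProductSpace.toDual_symm_apply]; rfl
  obtain ⟨v, hv, hvc⟩ := exists_unit_normal c'
  refine ⟨y, ?_, ?_, ?_⟩
  · intro b hb
    refine ⟨intForm B c ⟨b, hb⟩, ?_⟩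
    rw [hyx, hyperplaneForm_eq_mul_intForm B c ⟨b, hb⟩, ← mul_assoc, inv_mul_cancel₀ hD0, one_mul]
  · intro h0
    have h1 := hyx v
    rw [h0, inner_zero_left] at h1
    have h2 : hyperplaneForm c' v = 0 :=
      (mul_eq_zero.1 h1.symm).resolve_left (inv_ne_zero hD0)
    have h3 := abs_hyperplaneForm hc hv hvc v
    rw [h2, real_inner_self_eq_norm_sq, hv] at h3
    have h4 := (Matrix.posDef_gram_of_linearIndependent hc).det_pos
    have := Real.sqrt_pos.2 h4
    simp at h3
    rw [← h3] at this
    exact lt_irrefl _ this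
  · rcases eq_or_ne y 0 with h0 | h0
    · rw [h0]; simp
    have h1 := hyx y
    rw [real_inner_self_eq_norm_sq] at h1
    have h2 : ‖y‖ ^ 2 * |D| = |hyperplaneForm c' y| := by
      rw [← abs_of_nonneg (sq_nonneg ‖y‖), h1, abs_mul, abs_inv]
      field_simp
    have h3 := abs_hyperplaneForm_le hc y
    rw [hcov]
    refine le_of_mul_le_mul_left ?_ (norm_pos_iff.2 h0)
    calc _ = ‖y‖ ^ 2 * |D| := by ring
      _ ≤ _ := h2 ▸ h3

lemma exists_polar_ne_zero (L : Submodule ℤ (EuclideanSpace ℝ (Fin (d + 1))))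
    [DiscreteTopology L] [IsZLattice ℝ L] : ∃ y ∈ polarLattice L, y ≠ 0 := by
  obtain ⟨B⟩ := exists_zbasis L
  have h := linearIndependent_of_basis_sublattice le_rfl B
  obtain ⟨y, hy, hy0, -⟩ := exists_polar_norm_le (c := fun i : Fin d => B i.succ)
    (h.comp Fin.succ (Fin.succ_injective d))
  exact ⟨y, hy, hy0⟩

lemma firstMinimum_le {n : ℕ} {M : Submodule ℤ (EuclideanSpace ℝ (Fin n))}
    {y : EuclideanSpace ℝ (Fin n)} (hy : y ∈ M) (hy0 : y ≠ 0) : firstMinimum M ≤ ‖y‖ :=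
  csInf_le ⟨0, by rintro _ ⟨v, -, -, rfl⟩; exact norm_nonneg v⟩ ⟨y, hy, hy0, rfl⟩

/-- A nonzero polar vector pairs with some basis vector to a nonzero integer, which bounds its norm
from below. -/
lemma firstMinimum_polarLattice_pos (L : Submodule ℤ (EuclideanSpace ℝ (Fin (d + 1))))
    [DiscreteTopology L] [IsZLattice ℝ L] : 0 < firstMinimum (polarLattice L) := by
  obtain ⟨B⟩ := exists_zbasis L
  let b := B.ofZLatticeBasis ℝ L
  set s := ∑ i, ‖b i‖ with hs
  have hle : ∀ i, ‖b i‖ ≤ s := fun i =>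
    Finset.single_le_sum (f := fun i => ‖b i‖) (fun i _ => norm_nonneg _) (Finset.mem_univ i)
  have hs0 : 0 < s := lt_of_lt_of_le (norm_pos_iff.2 (b.ne_zero 0)) (hle 0)
  obtain ⟨y₀, hy₀, hy₀0⟩ := exists_polar_ne_zero L
  refine lt_of_lt_of_le (inv_pos.2 hs0) (le_csInf ⟨_, y₀, hy₀, hy₀0, rfl⟩ ?_)
  rintro _ ⟨y, hy, hy0, rfl⟩
  obtain ⟨i, hi⟩ : ∃ i, ⟪y, b i⟫ ≠ 0 := by
    by_contra! h
    refine hy0 (InnerProductSpace.ext_inner_right_basis b fun i => by rw [h i, inner_zero_left])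
  obtain ⟨k, hk⟩ := hy (b i) (by rw [B.ofZLatticeBasis_apply ℝ L i]; exact (B i).2)
  rw [hk] at hi
  have hk1 : (1 : ℝ) ≤ |(k : ℝ)| := by
    rw [← Int.cast_abs]
    exact_mod_cast Int.one_le_abs (by exact_mod_cast hi)
  have h1 := abs_real_inner_le_norm y (b i)
  rw [hk] at h1
  rw [inv_le_iff_one_le_mul₀ hs0]
  exact hk1.trans (h1.trans (mul_le_mul_of_nonneg_left (hle i) (norm_nonneg _)))

/-- The sublattice orthogonal to a vector of the polar lattice. -/
lemma exists_sublatticeDets_le {y : EuclideanSpace ℝ (Fin (d + 1))} (hy : y ∈ polarLattice L)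
    (hy0 : y ≠ 0) : ∃ r ∈ sublatticeDets L d, r ≤ ‖y‖ * ZLattice.covolume L := by
  have : Module.Finite ℤ L := ZLattice.module_finite ℝ L
  have : Module.Free ℤ L := ZLattice.module_free ℝ L
  obtain ⟨B⟩ := exists_zbasis L
  choose f hf using fun x : L => hy x x.2
  let F : L →ₗ[ℤ] ℤ := (AddMonoidHom.mk' f fun a b => by
    have : (f (a + b) : ℝ) = f a + f b := by
      rw [← hf, ← hf, ← hf, ← inner_add_right]; rfl
    exact_mod_cast this).toIntLinearMap
  have hF : ∀ x : L, ⟪y, (x : EuclideanSpace ℝ (Fin (d + 1)))⟫ = F x := hf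
  obtain ⟨g, hg⟩ := (IsPrincipalIdealRing.principal (LinearMap.range F)).principal
  obtain ⟨u, hu⟩ : ∃ u, F u = g := by
    have : g ∈ LinearMap.range F := hg ▸ Submodule.mem_span_singleton_self g
    exact this
  have hdvd : ∀ x, ∃ k : ℤ, F x = k * g := fun x => by
    have : F x ∈ LinearMap.range F := ⟨x, rfl⟩
    rw [hg, Submodule.mem_span_singleton] at this
    obtain ⟨k, hk⟩ := this
    exact ⟨k, by rw [← hk, smul_eq_mul]⟩
  have hg0 : g ≠ 0 := by
    rintro rfl
    refine hy0 (InnerProductSpace.ext_inner_right_basis (B.ofZLatticeBasis ℝ L) fun i => ?_)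
    rw [B.ofZLatticeBasis_apply ℝ L, hF, inner_zero_left]
    obtain ⟨k, hk⟩ := hdvd (B i)
    simp [hk]
  obtain ⟨m, bN⟩ := Submodule.basisOfPid B (LinearMap.ker F)
  have hli : ∀ (r : ℤ), ∀ x ∈ LinearMap.ker F, r • u + x = 0 → r = 0 := by
    intro r x hx h
    have h1 := congrArg F h
    rw [map_add, map_smul, LinearMap.mem_ker.1 hx, map_zero, add_zero, smul_eq_mul, hu] at h1
    exact (mul_eq_zero.1 h1).resolve_right hg0
  have hsp : ∀ z : L, ∃ r : ℤ, z + r • u ∈ LinearMap.ker F := by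
    intro z
    obtain ⟨k, hk⟩ := hdvd z
    refine ⟨-k, ?_⟩
    rw [LinearMap.mem_ker, map_add, map_smul, hk, hu]
    simp
  -- Since `u` attains the generator `g` of the values of `⟪y, ·⟫`, it completes a basis of the
  -- kernel to one of `L`. The height of `u` over the kernel is `|g| / ‖y‖`, and `|g| ≥ 1`.
  let B' : Basis (Fin (m + 1)) ℤ L := Basis.mkFinCons u bN hli hsp
  have hm : m = d := by
    have h1 := finrank_eq_card_basis B
    rw [finrank_eq_card_basis B', Fintype.card_fin, Fintype.card_fin] at h1
    omega
  subst hm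
  let e := (LinearMap.ker F).equivMapOfInjective L.subtype L.injective_subtype
  let bM := bN.map e
  have hMle : (LinearMap.ker F).map L.subtype ≤ L := Submodule.map_subtype_le L _
  have hbM : ∀ i, (bM i : EuclideanSpace ℝ (Fin (m + 1))) = ((bN i : L) : EuclideanSpace ℝ (Fin (m + 1))) :=
    fun i => by simp [bM, e]
  refine ⟨_, ⟨_, hMle, bM, rfl⟩, ?_⟩
  have hlin := linearIndependent_of_basis_sublattice hMle bM
  have hny : ‖y‖ ≠ 0 := norm_ne_zero_iff.2 hy0
  have h1 := abs_hyperplaneForm hlin (v := (‖y‖⁻¹ : ℝ) • y) (norm_smul_inv_norm hy0) (fun i => by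
    rw [real_inner_smul_left, hbM, hF, LinearMap.mem_ker.1 (bN i).2]; simp) u
  have h2 : ZLattice.covolume L =
      |hyperplaneForm (fun i => (bM i : EuclideanSpace ℝ (Fin (m + 1)))) u| := by
    rw [covolume_eq_abs_stdDet L B', hyperplaneForm_apply]
    congr 2
    ext1 i
    simp only [B', Basis.coe_mkFinCons]
    refine Fin.cases ?_ (fun i => ?_) i
    · simp
    · simp [hbM]
  rw [h2, h1, real_inner_smul_left, hF, hu, abs_mul, abs_inv, abs_norm]
  have hg1 : (1 : ℝ) ≤ |(g : ℝ)| := by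
    rw [← Int.cast_abs]
    exact_mod_cast Int.one_le_abs hg0
  calc √(Matrix.gram ℝ fun i => (bM i : EuclideanSpace ℝ (Fin (m + 1)))).det
      ≤ |(g : ℝ)| * √(Matrix.gram ℝ fun i => (bM i : EuclideanSpace ℝ (Fin (m + 1)))).det :=
        le_mul_of_one_le_left (Real.sqrt_nonneg _) hg1
    _ = _ := by field_simp

/-- A polar vector gives the sublattice orthogonal to it, and a sublattice gives a polar normal
vector; both passages have the inequality in the required direction. -/
lemma minSublatticeDet_eq (L : Submodule ℤ (EuclideanSpace ℝ (Fin (d + 1))))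
    [DiscreteTopology L] [IsZLattice ℝ L] :
    minSublatticeDet L d = firstMinimum (polarLattice L) * ZLattice.covolume L := by
  have hpos := ZLattice.covolume_pos L
  have hbdd : BddBelow (sublatticeDets L d) :=
    ⟨0, by rintro _ ⟨M, -, b, rfl⟩; exact Real.sqrt_nonneg _⟩
  obtain ⟨y₀, hy₀, hy₀0⟩ := exists_polar_ne_zero L
  refine le_antisymm ?_ ?_
  · rw [← div_le_iff₀ hpos]
    refine le_csInf ⟨_, y₀, hy₀, hy₀0, rfl⟩ ?_
    rintro _ ⟨y, hy, hy0, rfl⟩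
    rw [div_le_iff₀ hpos]
    obtain ⟨r, hr, hle⟩ := exists_sublatticeDets_le hy hy0
    exact (csInf_le hbdd hr).trans hle
  · obtain ⟨r₀, hr₀, -⟩ := exists_sublatticeDets_le hy₀ hy₀0
    refine le_csInf ⟨r₀, hr₀⟩ ?_
    rintro _ ⟨M, hM, b, rfl⟩
    obtain ⟨y, hy, hy0, hle⟩ := exists_polar_norm_le (c := fun i => (⟨b i, hM (b i).2⟩ : L))
      (linearIndependent_of_basis_sublattice hM b)
    exact (mul_le_mul_of_nonneg_right (firstMinimum_le hy hy0) hpos.le).trans hle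

lemma minSublatticeDet_le {c : Fin d → L}
    (hc : LinearIndependent ℝ fun i => (c i : EuclideanSpace ℝ (Fin (d + 1)))) :
    minSublatticeDet L d ≤
      √(Matrix.gram ℝ fun i => (c i : EuclideanSpace ℝ (Fin (d + 1)))).det := by
  obtain ⟨y, hy, hy0, hle⟩ := exists_polar_norm_le hc
  rw [minSublatticeDet_eq]
  exact (mul_le_mul_of_nonneg_right (firstMinimum_le hy hy0)
    (ZLattice.covolume_pos L).le).trans hle

end Minima

/-! ### Counting the segments that cross a lattice simplex. -/

section Counting

variable {d : ℕ} {L : Submodule ℤ (EuclideanSpace ℝ (Fin (d + 1)))} [DiscreteTopology L]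
  [IsZLattice ℝ L]

/-- The index of a full-rank sublattice is the absolute determinant of its basis in lattice
coordinates. -/
lemma card_quotient_span_cons (B : Basis (Fin (d + 1)) ℤ L) (c : Fin d → L) (u : L)
    (hu : intForm B c u ≠ 0) :
    Nat.card (L ⧸ Submodule.span ℤ (Set.range (Fin.cons u c : Fin (d + 1) → L))) =
      (intForm B c u).natAbs := by
  have : Module.Finite ℤ L := ZLattice.module_finite ℝ L
  have : Module.Free ℤ L := ZLattice.module_free ℝ L
  set v : Fin (d + 1) → L := Fin.cons u c with hv
  have hli : LinearIndependent ℤ v := by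
    have h1 : LinearIndependent ℝ (fun i => (v i : EuclideanSpace ℝ (Fin (d + 1)))) := by
      by_contra hdep
      have h2 := (stdDet (d + 1)).map_linearDependent _ hdep
      rw [stdDet_eq_mul_intDet B v] at h2
      rcases mul_eq_zero.1 h2 with h3 | h3
      · have h4 := ZLattice.covolume_pos L
        rw [covolume_eq_abs_stdDet L B, h3] at h4
        simp at h4
      · exact hu (by exact_mod_cast h3)
    have h2 : LinearIndependent ℤ (L.subtype ∘ v) :=
      h1.restrict_scalars (by
        intro a b hab
        simpa using hab)
    exact h2.of_comp L.subtype
  have h := Submodule.natAbs_det_basis_change B _ (Basis.span hli)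
  have h1 : Subtype.val ∘ Basis.span hli = v := funext fun i => congrArg Subtype.val (Basis.span_apply hli i)
  rw [h1] at h
  exact h.symm

/-- The number of lattice points `z` for which the segment `[z, z + t]` properly crosses a lattice
simplex with edge vectors `c` is at most `|det (t, c)| / det L`. -/
lemma card_crossing_le {a : Fin (d + 1) → L}
    (hli : LinearIndependent ℝ fun i : Fin d =>
      ((a i.succ - a 0 : L) : EuclideanSpace ℝ (Fin (d + 1))))
    {t : EuclideanSpace ℝ (Fin (d + 1))} (hgen : 0 < d → ∀ b ∈ L, ∀ r : ℝ, r • b ≠ t)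
    (T : Finset L)
    (hT : ∀ z ∈ T, ∃ s : ℝ, 0 < s ∧ s < 1 ∧ ∃ l : Fin (d + 1) → ℝ, (∀ i, 0 ≤ l i) ∧
      ∑ i, l i = 1 ∧ ∑ i, l i • (a i : EuclideanSpace ℝ (Fin (d + 1))) = z + s • t)
    (hne : ∀ z ∈ T, hyperplaneForm
      (fun i : Fin d => ((a i.succ - a 0 : L) : EuclideanSpace ℝ (Fin (d + 1))))
      ((z - a 0 : L) : EuclideanSpace ℝ (Fin (d + 1))) ≠ 0) :
    (T.card : ℝ) * ZLattice.covolume L ≤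
      |hyperplaneForm
        (fun i : Fin d => ((a i.succ - a 0 : L) : EuclideanSpace ℝ (Fin (d + 1)))) t| := by
  classical
  obtain ⟨B⟩ := exists_zbasis L
  set c : Fin d → L := fun i => a i.succ - a 0 with hc
  set H := hyperplaneForm (fun i : Fin d => (c i : EuclideanSpace ℝ (Fin (d + 1)))) with hH
  set D := stdDet (d + 1) (fun i => (B i : EuclideanSpace ℝ (Fin (d + 1)))) with hD
  have hpos := ZLattice.covolume_pos L
  have hcov : ZLattice.covolume L = |D| := covolume_eq_abs_stdDet L B
  have hD0 : D ≠ 0 := by intro h; rw [hcov, h] at hpos; simp at hpos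
  have hHI : ∀ x : L, H x = D * (intForm B c x : ℝ) := hyperplaneForm_eq_mul_intForm B c
  rcases T.eq_empty_or_nonempty with rfl | ⟨z₀, hz₀⟩
  · simp
  choose! s hs0 hs1 l hl0 hl1 hlx using hT
  have hsum : ∀ z ∈ T, ∑ i : Fin d, l z i.succ • (c i : EuclideanSpace ℝ (Fin (d + 1))) =
      (z - a 0 : L) + s z • t := by
    intro z hz
    have h1 := hlx z hz
    have h2 := hl1 z hz
    rw [Fin.sum_univ_succ] at h1 h2
    simp only [hc, AddSubgroupClass.coe_sub, smul_sub, Finset.sum_sub_distrib]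
    rw [← Finset.sum_smul, show ∑ i : Fin d, l z i.succ = 1 - l z 0 by linarith, sub_smul, one_smul]
    have h3 : ∑ i : Fin d, l z i.succ • (a i.succ : EuclideanSpace ℝ (Fin (d + 1))) =
        z + s z • t - l z 0 • (a 0 : EuclideanSpace ℝ (Fin (d + 1))) := by
      rw [← h1]; abel
    rw [h3]; abel
  -- The crossing point lies in the hyperplane of the simplex, so the integral height of `z`
  -- determines the crossing time.
  have hHz : ∀ z ∈ T, (intForm B c (a 0 - z) : ℝ) = s z * (H t / D) := by
    intro z hz
    have h1 : H ((z - a 0 : L) + s z • t) = 0 := by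
      rw [← hsum z hz]
      refine hyperplaneForm_eq_zero_of_mem_span (Submodule.sum_mem _ fun i _ =>
        Submodule.smul_mem _ _ (Submodule.subset_span ⟨i, rfl⟩))
    rw [map_add, map_smul, hHI, smul_eq_mul] at h1
    have h2 : intForm B c (a 0 - z) = -intForm B c (z - a 0) := by
      rw [← map_neg, neg_sub]
    rw [h2]
    push_cast
    field_simp
    linarith
  obtain ⟨g, hg⟩ := (IsPrincipalIdealRing.principal (LinearMap.range (intForm B c))).principal
  obtain ⟨u, hu⟩ : ∃ u, intForm B c u = g := by
    have : g ∈ LinearMap.range (intForm B c) := hg ▸ Submodule.mem_span_singleton_self g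
    exact this
  have hdvd : ∀ x, ∃ k : ℤ, intForm B c x = k * g := fun x => by
    have : intForm B c x ∈ LinearMap.range (intForm B c) := ⟨x, rfl⟩
    rw [hg, Submodule.mem_span_singleton] at this
    obtain ⟨k, hk⟩ := this
    exact ⟨k, by rw [← hk, smul_eq_mul]⟩
  have hI0 : ∀ z ∈ T, intForm B c (a 0 - z) ≠ 0 := by
    intro z hz h0
    refine hne z hz ?_
    rw [hHI, ← neg_sub, map_neg, h0]; simp
  have hg0 : g ≠ 0 := by
    rintro rfl
    obtain ⟨k, hk⟩ := hdvd (a 0 - z₀)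
    exact hI0 z₀ hz₀ (by rw [hk, mul_zero])
  have hgpos : 0 < |(g : ℝ)| := abs_pos.2 (by exact_mod_cast hg0)
  set τ := H t / D with hτ
  have hτ0 : τ ≠ 0 := by
    intro h0
    have := hHz z₀ hz₀
    rw [h0, mul_zero] at this
    exact hI0 z₀ hz₀ (by exact_mod_cast this)
  choose k hk using fun z : L => hdvd (a 0 - z)
  have hkabs : ∀ z ∈ T, ((k z).natAbs : ℝ) * |(g : ℝ)| = s z * |τ| := by
    intro z hz
    rw [Nat.cast_natAbs, Int.cast_abs, ← abs_mul, ← abs_of_pos (hs0 z hz), ← abs_mul,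
      ← hHz z hz, hk z]
    push_cast
    rfl
  set N := Submodule.span ℤ (Set.range (Fin.cons u c : Fin (d + 1) → L)) with hN
  have hcard : Nat.card (L ⧸ N) = g.natAbs := by
    rw [hN, card_quotient_span_cons B c u (by rw [hu]; exact hg0), hu]
  have : Finite (L ⧸ N) := Nat.finite_of_card_ne_zero (by rw [hcard]; simpa using hg0)
  have : Fintype (L ⧸ N) := Fintype.ofFinite _
  -- There are `|g|` classes modulo `N` and at most `|τ| / |g|` levels, so injectivity gives the
  -- bound `|τ|`. Two points with the same class and level differ by an integral combination of the
  -- edges, and so do their crossing points.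
  have hinj : Set.InjOn (fun z : L => ((Submodule.Quotient.mk z : L ⧸ N), (k z).natAbs)) T := by
    intro z hz z' hz' heq
    have hz : z ∈ T := hz
    have hz' : z' ∈ T := hz'
    obtain ⟨hq, hkk⟩ := Prod.mk.inj heq
    have hss : s z = s z' := by
      have h1 := hkabs z hz
      have h2 := hkabs z' hz'
      rw [hkk, h2] at h1
      exact (mul_right_cancel₀ (abs_ne_zero.2 hτ0) h1).symm
    have hII : intForm B c (z - z') = 0 := by
      have h1 := hHz z hz
      rw [hss, ← hHz z' hz'] at h1
      have h2 : intForm B c (a 0 - z) = intForm B c (a 0 - z') := by exact_mod_cast h1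
      have h3 : z - z' = (a 0 - z') - (a 0 - z) := by abel
      rw [h3, map_sub, h2, sub_self]
    have hmem : z - z' ∈ N := (Submodule.Quotient.eq N).1 hq
    rw [hN, Submodule.mem_span_range_iff_exists_fun] at hmem
    obtain ⟨m, hm⟩ := hmem
    rw [Fin.sum_univ_succ] at hm
    simp only [Fin.cons_zero, Fin.cons_succ] at hm
    have hIc : ∀ i, intForm B c (c i) = 0 := fun i =>
      B.det.map_eq_zero_of_eq (i := 0) (j := i.succ) _ (by simp) (Fin.succ_ne_zero i).symm
    have hm0 : m 0 = 0 := by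
      rw [← hm, map_add, map_smul, map_sum, hu] at hII
      simp only [map_smul, hIc, smul_eq_mul, mul_zero, Finset.sum_const_zero, add_zero] at hII
      exact (mul_eq_zero.1 hII).resolve_right hg0
    rw [hm0, zero_smul, zero_add] at hm
    have hlm : ∀ i : Fin d, l z i.succ - l z' i.succ = m i.succ := by
      have h1 : ∑ i : Fin d, (l z i.succ - l z' i.succ - m i.succ) •
          (c i : EuclideanSpace ℝ (Fin (d + 1))) = 0 := by
        have h2 := congrArg (L.subtype) hm
        simp only [map_sum, map_smul, Submodule.subtype_apply] at h2
        simp only [sub_smul, Finset.sum_sub_distrib, hsum z hz, hsum z' hz', hss]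
        simp only [Int.cast_smul_eq_zsmul]
        rw [h2]
        simp only [AddSubgroupClass.coe_sub]
        abel
      intro i
      exact sub_eq_zero.1 (Fintype.linearIndependent_iff.1 hli _ h1 i)
    -- A barycentric coordinate of at least `1` puts the crossing at a vertex, making `t` a multiple
    -- of a lattice vector. Hence coordinates differing by integers must agree.
    have hvertex : ∀ z ∈ T, ∀ i : Fin d, ¬ (1 ≤ l z i.succ) := by
      intro z hz i hi
      have h1 : ∀ j, j ≠ i.succ → l z j = 0 := by
        intro j hj
        have h2 := hl1 z hz
        have h3 := Finset.sum_le_sum_of_subset_of_nonneg (f := l z)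
          (Finset.subset_univ ({j, i.succ} : Finset (Fin (d + 1)))) fun x _ _ => hl0 z hz x
        rw [Finset.sum_pair hj, h2] at h3
        exact le_antisymm (by linarith) (hl0 z hz j)
      have h2 : l z i.succ = 1 := by
        rw [← hl1 z hz]
        exact (Finset.sum_eq_single _ (fun j _ hj => h1 j hj) (by simp)).symm
      have h3 := hlx z hz
      rw [Finset.sum_eq_single i.succ (fun j _ hj => by rw [h1 j hj, zero_smul]) (by simp), h2,
        one_smul] at h3
      refine hgen i.pos (a i.succ - z : L) (a i.succ - z : L).2 (s z)⁻¹ ?_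
      rw [AddSubgroupClass.coe_sub, h3, add_sub_cancel_left, smul_smul,
        inv_mul_cancel₀ (hs0 z hz).ne', one_smul]
    have hmi : ∀ i : Fin d, m i.succ = 0 := by
      intro i
      by_contra h0
      rcases lt_or_gt_of_ne h0 with h1 | h1
      · refine hvertex z' hz' i ?_
        have h2 : (m i.succ : ℝ) ≤ -1 := by exact_mod_cast Int.le_sub_one_of_lt h1
        have := hlm i
        have := hl0 z hz i.succ
        linarith
      · refine hvertex z hz i ?_
        have h2 : (1 : ℝ) ≤ m i.succ := by exact_mod_cast h1
        have := hlm i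
        have := hl0 z' hz' i.succ
        linarith
    rw [← sub_eq_zero, ← hm]
    simp [hmi]
  have hmaps : Set.MapsTo (fun z : L => ((Submodule.Quotient.mk z : L ⧸ N), (k z).natAbs)) T
      ((Finset.univ : Finset (L ⧸ N)) ×ˢ Finset.Icc 1 ⌊|τ| / |(g : ℝ)|⌋₊ : Finset _) := by
    intro z hz
    have hz : z ∈ T := hz
    simp only [Finset.coe_product, Finset.coe_univ, Finset.coe_Icc, Set.mem_prod, Set.mem_univ,
      true_and, Set.mem_Icc]
    constructor
    · rw [Nat.one_le_iff_ne_zero, Int.natAbs_ne_zero]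
      intro h0
      exact hI0 z hz (by rw [hk, h0, zero_mul])
    · refine Nat.le_floor ?_
      rw [le_div_iff₀ hgpos, hkabs z hz]
      exact mul_le_of_le_one_left (abs_nonneg _) (hs1 z hz).le
  have hle := Finset.card_le_card_of_injOn _ hmaps hinj
  rw [Finset.card_product, Finset.card_univ, ← Nat.card_eq_fintype_card, hcard, Nat.card_Icc,
    Nat.add_sub_cancel] at hle
  have h1 : (T.card : ℝ) ≤ |τ| := by
    calc (T.card : ℝ) ≤ (g.natAbs * ⌊|τ| / |(g : ℝ)|⌋₊ : ℕ) := by exact_mod_cast hle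
      _ = |(g : ℝ)| * ⌊|τ| / |(g : ℝ)|⌋₊ := by
        push_cast [Nat.cast_natAbs]; rfl
      _ ≤ |(g : ℝ)| * (|τ| / |(g : ℝ)|) :=
        mul_le_mul_of_nonneg_left (Nat.floor_le (by positivity)) hgpos.le
      _ = |τ| := by field_simp
  calc (T.card : ℝ) * ZLattice.covolume L ≤ |τ| * |D| := by
        rw [hcov]; exact mul_le_mul_of_nonneg_right h1 (abs_nonneg _)
    _ = |H t| := by rw [← abs_mul, hτ, div_mul_cancel₀ _ hD0]

end Counting

/-! ### Choosing the translation vector. -/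

section Translation

variable {d : ℕ} {L : Submodule ℤ (EuclideanSpace ℝ (Fin (d + 1)))} [DiscreteTopology L]
  [IsZLattice ℝ L]

/-- The cell is symmetric, so a ball with any centre that contains it contains `t` and `-t`, and its
radius is at least `‖t‖`. Boundedness of the cell is also needed, since the infimum of the empty set
is `0`. -/
lemma norm_le_inhomogeneousMinimum {t : EuclideanSpace ℝ (Fin (d + 1))}
    (ht : t ∈ dirichletVoronoiCell L) : ‖t‖ ≤ inhomogeneousMinimum L := by
  obtain ⟨B⟩ := exists_zbasis L
  let b := B.ofZLatticeBasis ℝ L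
  refine le_csInf ⟨∑ i, ‖b i‖, 0, fun x hx => ?_⟩ ?_
  · rw [mem_closedBall_zero_iff]
    have hmem : (ZSpan.floor b x : EuclideanSpace ℝ (Fin (d + 1))) ∈ L :=
      (B.ofZLatticeBasis_span ℝ).le (ZSpan.floor b x).2
    exact (hx _ hmem).trans (ZSpan.norm_fract_le b x)
  · rintro r ⟨c, hc⟩
    have h1 := mem_closedBall_iff_norm.1 (hc ht)
    have hneg : -t ∈ dirichletVoronoiCell L := fun b hb => by
      have := ht (-b) (L.neg_mem hb)
      rwa [norm_neg, ← norm_neg (-t - b), show -(-t - b) = t - -b by abel]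
    have h2 := mem_closedBall_iff_norm.1 (hc hneg)
    have h3 : (2 : ℝ) • t = (t - c) - (-t - c) := by rw [two_smul]; abel
    have h4 : 2 * ‖t‖ ≤ r + r := by
      calc 2 * ‖t‖ = ‖(2 : ℝ) • t‖ := by rw [norm_smul]; norm_num
        _ ≤ ‖t - c‖ + ‖-t - c‖ := h3 ▸ norm_sub_le _ _
        _ ≤ r + r := add_le_add h1 h2
    linarith

lemma isClosed_lattice (L : Submodule ℤ (EuclideanSpace ℝ (Fin (d + 1)))) [DiscreteTopology L] :
    IsClosed (L : Set (EuclideanSpace ℝ (Fin (d + 1)))) :=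
  @AddSubgroup.isClosed_of_discrete _ _ _ _ _ L.toAddSubgroup ‹_›

lemma finite_inter_lattice (L : Submodule ℤ (EuclideanSpace ℝ (Fin (d + 1)))) [DiscreteTopology L]
    {K : Set (EuclideanSpace ℝ (Fin (d + 1)))} (hK : Bornology.IsBounded K) :
    (K ∩ L).Finite :=
  Metric.finite_isBounded_inter_isClosed DiscreteTopology.isDiscrete hK (isClosed_lattice L)

lemma finite_setOf_add_mem (L : Submodule ℤ (EuclideanSpace ℝ (Fin (d + 1)))) [DiscreteTopology L]
    {P : Set (EuclideanSpace ℝ (Fin (d + 1)))} (hP : IsCompact P)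
    (x : EuclideanSpace ℝ (Fin (d + 1))) :
    {z : L | (z + x : EuclideanSpace ℝ (Fin (d + 1))) ∈ P}.Finite := by
  have h1 := finite_inter_lattice L (hP.image (continuous_sub_right x)).isBounded
  refine Set.Finite.of_finite_image (f := Subtype.val) (h1.subset ?_) Subtype.val_injective.injOn
  rintro _ ⟨z, hz, rfl⟩
  exact ⟨⟨_, hz, by simp⟩, z.2⟩

lemma exists_sub_mem_dirichletVoronoiCell (L : Submodule ℤ (EuclideanSpace ℝ (Fin (d + 1))))
    [DiscreteTopology L] (x : EuclideanSpace ℝ (Fin (d + 1))) :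
    ∃ b ∈ L, x - b ∈ dirichletVoronoiCell L := by
  obtain ⟨b, hb, hbx⟩ := (isClosed_lattice L).exists_infDist_eq_dist ⟨0, L.zero_mem⟩ x
  refine ⟨b, hb, fun v hv => ?_⟩
  have h1 := Metric.infDist_le_dist_of_mem (x := x) (L.add_mem hb hv)
  rw [hbx, dist_eq_norm, dist_eq_norm] at h1
  rwa [sub_sub]

lemma ae_notMem_lattice_line (L : Submodule ℤ (EuclideanSpace ℝ (Fin (d + 1))))
    [DiscreteTopology L] [IsZLattice ℝ L] (hd : 0 < d) :
    ∀ᵐ x : EuclideanSpace ℝ (Fin (d + 1)), ∀ b v : L, ∀ r : ℝ,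
      r • (b : EuclideanSpace ℝ (Fin (d + 1))) ≠ x - v := by
  rw [ae_all_iff]; intro b
  rw [ae_all_iff]; intro v
  set A : AffineSubspace ℝ (EuclideanSpace ℝ (Fin (d + 1))) :=
    AffineSubspace.mk' (v : EuclideanSpace ℝ (Fin (d + 1)))
      (ℝ ∙ (b : EuclideanSpace ℝ (Fin (d + 1)))) with hA
  have hne : A ≠ ⊤ := by
    intro h
    have h1 : A.direction = ⊤ := by rw [h, AffineSubspace.direction_top]
    rw [hA, AffineSubspace.direction_mk'] at h1
    have h2 := finrank_span_le_card (R := ℝ) ({(b : EuclideanSpace ℝ (Fin (d + 1)))} : Set _)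
    rw [h1, finrank_top] at h2
    simp at h2
    omega
  have := Measure.addHaar_affineSubspace volume A hne
  refine (measure_eq_zero_iff_ae_notMem.1 this).mono fun x hx r hr => hx ?_
  rw [SetLike.mem_coe, hA, AffineSubspace.mem_mk', vsub_eq_sub, ← hr]
  exact Submodule.smul_mem _ _ (Submodule.mem_span_singleton_self _)

/-- Some translate of a bounded set by a generic vector of the Dirichlet-Voronoi cell contains at
most as many lattice points as its volume suggests. -/
lemma exists_translate_ncard_le (L : Submodule ℤ (EuclideanSpace ℝ (Fin (d + 1))))
    [DiscreteTopology L] [IsZLattice ℝ L] {P : Set (EuclideanSpace ℝ (Fin (d + 1)))}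
    (hP : IsCompact P) : ∃ t ∈ dirichletVoronoiCell L,
      (0 < d → ∀ b ∈ L, ∀ r : ℝ, r • b ≠ t) ∧
      ({z : L | (z + t : EuclideanSpace ℝ (Fin (d + 1))) ∈ P}.ncard : ℝ) * ZLattice.covolume L ≤
        (volume P).toReal := by
  classical
  obtain ⟨B⟩ := exists_zbasis L
  set F := ZSpan.fundamentalDomain (B.ofZLatticeBasis ℝ L) with hFdef
  have hF : IsAddFundamentalDomain L F volume := ZLattice.isAddFundamentalDomain B volume
  have hcov := ZLattice.covolume_eq_measure_fundamentalDomain L volume hF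
  have hpos := ZLattice.covolume_pos L
  have : MeasurableVAdd L (EuclideanSpace ℝ (Fin (d + 1))) :=
    (inferInstance : MeasurableVAdd L.toAddSubgroup _)
  have : VAddInvariantMeasure L (EuclideanSpace ℝ (Fin (d + 1))) volume :=
    (inferInstance : VAddInvariantMeasure L.toAddSubgroup _ volume)
  have hF0 : volume F ≠ 0 := by
    intro h
    rw [hcov, measureReal_def, h] at hpos
    simp at hpos
  have hFtop : volume F ≠ ⊤ :=
    ((ZSpan.fundamentalDomain_isBounded _).measure_lt_top).ne
  set f : EuclideanSpace ℝ (Fin (d + 1)) → ENNReal :=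
    fun x => ∑' z : L, P.indicator 1 ((z : EuclideanSpace ℝ (Fin (d + 1))) + x) with hf
  have hmeas : ∀ z : L, Measurable fun x : EuclideanSpace ℝ (Fin (d + 1)) =>
      (P.indicator 1 ((z : EuclideanSpace ℝ (Fin (d + 1))) + x) : ENNReal) := fun z =>
    (measurable_one.indicator hP.measurableSet).comp (measurable_const_add _)
  have hfm : Measurable f := Measurable.tsum hmeas
  -- Unfolding: the translates of `F` by lattice vectors tile the space.
  have hint : ∫⁻ x in F, f x = volume P := by
    rw [hf, lintegral_tsum fun z => (hmeas z).aemeasurable,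
      ← lintegral_indicator_one hP.measurableSet, hF.lintegral_eq_tsum'']
    rfl
  have hfin := finite_setOf_add_mem L hP
  have hfcard : ∀ x, f x =
      ({z : L | (z + x : EuclideanSpace ℝ (Fin (d + 1))) ∈ P}.ncard : ENNReal) := by
    intro x
    rw [hf]
    simp only
    rw [tsum_eq_sum (s := (hfin x).toFinset) fun z hz => by
      rw [Set.indicator_of_notMem]; simpa using hz]
    rw [Finset.sum_congr rfl fun z hz => Set.indicator_of_mem (by simpa using hz) _,
      Set.ncard_eq_toFinset_card _ (hfin x)]
    simp
  -- The points of `F` where `f` is at most its average have positive measure, so one of them is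
  -- generic. Reducing it into the Voronoi cell only reindexes the lattice points counted.
  have hposset := measure_le_setLAverage_pos hF0 hFtop hfm.aemeasurable
  have hgen : ∀ᵐ x : EuclideanSpace ℝ (Fin (d + 1)), 0 < d → ∀ b v : L, ∀ r : ℝ,
      r • (b : EuclideanSpace ℝ (Fin (d + 1))) ≠ x - v := by
    by_cases hd : 0 < d
    · filter_upwards [ae_notMem_lattice_line L hd] with x hx _ using hx
    · exact Filter.Eventually.of_forall fun x h => absurd h hd
  obtain ⟨x, ⟨-, hxle⟩, hxgen⟩ : ∃ x, (x ∈ F ∧ f x ≤ ⨍⁻ a in F, f a ∂volume) ∧ (0 < d → ∀ b v : L, ∀ r : ℝ,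
      r • (b : EuclideanSpace ℝ (Fin (d + 1))) ≠ x - v) := by
    by_contra! hcon
    refine hposset.ne' (measure_mono_null (fun x hx => ?_) (ae_iff.1 hgen))
    intro h
    obtain ⟨hd, b, v, r, h1⟩ := hcon x hx
    exact h hd b v r h1
  obtain ⟨v, hv, hvx⟩ := exists_sub_mem_dirichletVoronoiCell L x
  refine ⟨x - v, hvx, fun hd b hb r => hxgen hd ⟨b, hb⟩ ⟨v, hv⟩ r, ?_⟩
  have hshift : {z : L | (z + (x - v) : EuclideanSpace ℝ (Fin (d + 1))) ∈ P}.ncard =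
      {z : L | (z + x : EuclideanSpace ℝ (Fin (d + 1))) ∈ P}.ncard := by
    rw [← Set.ncard_image_of_injective _ (add_right_injective (-⟨v, hv⟩ : L))]
    congr 1
    ext z
    constructor
    · rintro ⟨z, hz, rfl⟩
      simp only [Set.mem_ofPred_eq, Submodule.coe_add, Submodule.coe_neg] at hz ⊢
      convert hz using 1
      abel
    · intro hz
      refine ⟨z + ⟨v, hv⟩, ?_, by simp⟩
      simp only [Set.mem_ofPred_eq, Submodule.coe_add] at hz ⊢
      convert hz using 1
      abel
  rw [hshift]
  rw [setLAverage_eq, hint, hfcard, ENNReal.le_div_iff_mul_le (Or.inl hF0) (Or.inl hFtop)] at hxle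
  have := ENNReal.toReal_mono hP.measure_lt_top.ne hxle
  rw [ENNReal.toReal_mul, ENNReal.toReal_natCast] at this
  rw [hcov]
  exact this

end Translation

/-! ### Volumes of simplices. -/

section SimplexVolume

/-- The open standard simplex with a vertex at the origin. -/
def openSimplex (d : ℕ) : Set (Fin d → ℝ) := {l | (∀ i, 0 < l i) ∧ ∑ i, l i < 1}

lemma measurableSet_openSimplex (d : ℕ) : MeasurableSet (openSimplex d) := by
  have h1 : MeasurableSet {l : Fin d → ℝ | ∀ i, 0 < l i} := by
    simp only [Set.ofPred_forall]
    exact MeasurableSet.iInter fun i => measurableSet_lt measurable_const (measurable_pi_apply i)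
  exact h1.inter (measurableSet_lt (f := fun l : Fin d → ℝ => ∑ i, l i) (by fun_prop)
    measurable_const)

lemma measurePreserving_signs {d : ℕ} (s : Fin d → Bool) :
    MeasurePreserving (fun (x : Fin d → ℝ) i => if s i then x i else -x i) := by
  refine volume_preserving_pi (f := fun i (r : ℝ) => if s i then r else -r) fun i => ?_
  cases s i
  · simpa using! Measure.measurePreserving_neg (volume : Measure ℝ)
  · simpa using! MeasurePreserving.id (volume : Measure ℝ)

/-- Up to the coordinate hyperplanes, the `ℓ¹` unit ball, of volume `2 ^ d / d!`, is covered by `2 ^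
d` reflected copies of the simplex. -/
lemma le_volume_openSimplex (d : ℕ) :
    ENNReal.ofReal (1 / (d ! : ℝ)) ≤ volume (openSimplex d) := by
  classical
  set X : Set (Fin d → ℝ) := {x | ∑ i, |x i| ^ (1 : ℝ) < 1} with hX
  have hvX : volume X = ENNReal.ofReal (2 ^ d * (1 / (d ! : ℝ))) := by
    rw [hX, volume_sum_rpow_lt_one (Fin d) le_rfl]
    congr 1
    have h2 : Real.Gamma (1 / 1 + 1) = 1 := by
      norm_num [Real.Gamma_two]
    rw [h2, Fintype.card_fin, div_one, Real.Gamma_nat_eq_factorial]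
    ring
  have hcover : X ⊆ (⋃ s : Fin d → Bool,
      (fun (x : Fin d → ℝ) i => if s i then x i else -x i) ⁻¹' openSimplex d) ∪
      ⋃ i, {x | x i = 0} := by
    intro x hx
    by_cases h0 : ∃ i, x i = 0
    · obtain ⟨i, hi⟩ := h0
      exact Or.inr (Set.mem_iUnion.2 ⟨i, hi⟩)
    push Not at h0
    refine Or.inl (Set.mem_iUnion.2 ⟨fun i => decide (0 < x i), ?_⟩)
    have habs : ∀ i, (if decide (0 < x i) then x i else -x i) = |x i| := by
      intro i
      by_cases hi : 0 < x i
      · simp [hi, abs_of_pos hi]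
      · simp [hi, abs_of_nonpos (not_lt.1 hi)]
    refine ⟨fun i => ?_, ?_⟩
    · simp only [habs]; exact abs_pos.2 (h0 i)
    · simp only [habs]
      simpa [hX] using hx
  have h1 : volume X ≤ 2 ^ d * volume (openSimplex d) := by
    refine (measure_mono hcover).trans ((measure_union_le _ _).trans ?_)
    have hz : volume (⋃ i, {x : Fin d → ℝ | x i = 0}) = 0 :=
      measure_iUnion_null fun i => Measure.pi_hyperplane (fun _ : Fin d => (volume : Measure ℝ)) i 0
    rw [hz, add_zero]
    refine (measure_iUnion_fintype_le _ _).trans (le_of_eq ?_)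
    have : ∀ s : Fin d → Bool, volume ((fun (x : Fin d → ℝ) i => if s i then x i else -x i) ⁻¹'
        openSimplex d) = volume (openSimplex d) := fun s =>
      (measurePreserving_signs s).measure_preimage (measurableSet_openSimplex d).nullMeasurableSet
    rw [Finset.sum_congr rfl fun s _ => this s]
    simp
  rw [hvX, ENNReal.ofReal_mul (by positivity), ENNReal.ofReal_pow (by norm_num)] at h1
  rw [show ENNReal.ofReal 2 = 2 by norm_num] at h1
  exact (ENNReal.mul_le_mul_iff_right (by positivity) (by simp)).1 h1

/-- The volume of a simplex. -/
lemma le_volume_simplex {d : ℕ} (p : EuclideanSpace ℝ (Fin d))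
    (v : Fin d → EuclideanSpace ℝ (Fin d)) :
    ENNReal.ofReal (√(Matrix.gram ℝ v).det / (d ! : ℝ)) ≤
      volume ((fun l : Fin d → ℝ => p + ∑ i, l i • v i) '' openSimplex d) := by
  let b := (EuclideanSpace.basisFun (Fin d) ℝ).toBasis
  let f : EuclideanSpace ℝ (Fin d) →ₗ[ℝ] EuclideanSpace ℝ (Fin d) := b.constr ℝ v
  have hf : ∀ l : Fin d → ℝ, f (WithLp.toLp 2 l) = ∑ i, l i • v i := by
    intro l
    rw [Basis.constr_apply_fintype]
    rfl
  have hdet : |LinearMap.det f| = √(Matrix.gram ℝ v).det := by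
    rw [← abs_stdDet]
    have h1 : stdDet d (f ∘ b) = LinearMap.det f * stdDet d b := b.det_comp f b
    have h2 : f ∘ b = v := funext fun i => b.constr_basis ℝ v i
    rw [h2, show stdDet d b = 1 from b.det_self, mul_one] at h1
    rw [h1]
  have himg : (fun l : Fin d → ℝ => p + ∑ i, l i • v i) '' openSimplex d =
      (fun x => p + x) '' (f '' (WithLp.toLp 2 '' openSimplex d)) := by
    rw [Set.image_image, Set.image_image]
    simp only [hf]
  have hvol : volume ((WithLp.toLp 2 : (Fin d → ℝ) → EuclideanSpace ℝ (Fin d)) '' openSimplex d) =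
      volume (openSimplex d) := by
    rw [← (PiLp.volume_preserving_toLp (Fin d)).measure_preimage_emb
      (MeasurableEquiv.toLp 2 (Fin d → ℝ)).measurableEmbedding,
      Set.preimage_image_eq _ (WithLp.toLp_injective 2)]
  rw [himg, Set.image_add_left, measure_preimage_add, Measure.addHaar_image_linearMap, hvol, hdet,
    div_eq_mul_one_div, ENNReal.ofReal_mul (Real.sqrt_nonneg _)]
  gcongr
  exact le_volume_openSimplex d

end SimplexVolume

/-! ### Hausdorff measure under contractions; segments and rays leaving a closed set. -/

section Hausdorff

open Measure in
lemma euclideanHausdorffMeasure_image_le {X Y : Type*} [MetricSpace X] [MetricSpace Y]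
    [MeasurableSpace X] [BorelSpace X] [MeasurableSpace Y] [BorelSpace Y] {f : X → Y}
    (hf : LipschitzWith 1 f) (d : ℕ) (s : Set X) :
    μHE[d] (f '' s) ≤ μHE[d] s := by
  have h := hf.hausdorffMeasure_image_le (d := d) (Nat.cast_nonneg d) s
  simp only [ENNReal.coe_one, ENNReal.one_rpow, one_mul] at h
  simp only [euclideanHausdorffMeasure_def, Measure.smul_apply]
  gcongr

/-- Otherwise the connected segment would be split between the interior and the complement. -/
lemma exists_mem_frontier_segment {E : Type*} [NormedAddCommGroup E] [NormedSpace ℝ E] {K : Set E}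
    (hK : IsClosed K) {x v : E} (hx : x ∈ K) (hv : x + v ∉ K) :
    ∃ s : ℝ, 0 ≤ s ∧ s < 1 ∧ x + s • v ∈ frontier K := by
  by_contra! hcon
  have hsub : segment ℝ x (x + v) ⊆ interior K ∪ Kᶜ := by
    rintro z hz
    rw [segment_eq_image'] at hz
    obtain ⟨s, ⟨hs0, hs1⟩, rfl⟩ := hz
    simp only [add_sub_cancel_left]
    by_cases hzK : x + s • v ∈ K
    · left
      by_contra hi
      rcases hs1.eq_or_lt with rfl | hs1
      · exact hv (by simpa using hzK)
      · exact hcon s hs0 hs1 (hK.frontier_eq ▸ ⟨hzK, hi⟩)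
    · right; exact hzK
  have h1 := (convex_segment x (x + v)).isPreconnected.subset_left_of_subset_union isOpen_interior
    hK.isOpen_compl (Set.disjoint_left.2 fun z hz hz' => hz' (interior_subset hz)) hsub
    ⟨x, left_mem_segment ℝ _ _, by
      rcases hsub (left_mem_segment ℝ x (x + v)) with h | h
      · exact h
      · exact absurd hx h⟩
  exact hv (interior_subset (h1 (right_mem_segment ℝ _ _)))

/-- Rays starting in a bounded closed set leave it through the boundary. -/
lemma exists_mem_frontier_ray {E : Type*} [NormedAddCommGroup E] [NormedSpace ℝ E] {K : Set E}
    (hK : IsClosed K) (hb : Bornology.IsBounded K) {x v : E} (hx : x ∈ K) (hv : v ≠ 0) :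
    ∃ r : ℝ, 0 ≤ r ∧ x + r • v ∈ frontier K := by
  obtain ⟨R, hR⟩ := (Metric.isBounded_iff_subset_closedBall x).1 hb
  have hvn : 0 < ‖v‖ := norm_pos_iff.2 hv
  have hR0 : 0 ≤ R := by simpa using! (hR hx)
  obtain ⟨s, hs, -, hmem⟩ := exists_mem_frontier_segment hK (v := ((R + 1) / ‖v‖) • v) hx
    (fun h => by
      have := mem_closedBall_iff_norm.1 (hR h)
      rw [add_sub_cancel_left, norm_smul, Real.norm_of_nonneg (by positivity),
        div_mul_cancel₀ _ hvn.ne'] at this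
      linarith)
  exact ⟨s * ((R + 1) / ‖v‖), by positivity, by rwa [mul_smul]⟩

end Hausdorff

/-! ### Prisms over the simplices in normal direction. -/

section Prism

variable {d : ℕ}

/-- The relative interior of the simplex with vertices `a`. -/
def openFacet {E : Type*} [AddCommGroup E] [Module ℝ E] (a : Fin (d + 1) → E) : Set E :=
  {x | ∃ l : Fin (d + 1) → ℝ, (∀ i, 0 < l i) ∧ ∑ i, l i = 1 ∧ ∑ i, l i • a i = x}

/-- The half-open prism `openFacet a + ℝ≥0 y`. -/
def normalPrism {E : Type*} [AddCommGroup E] [Module ℝ E] (a : Fin (d + 1) → E) (y : E) : Set E :=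
  {z | ∃ x ∈ openFacet a, ∃ r : ℝ, 0 ≤ r ∧ x + r • y = z}

lemma add_sum_mem_openFacet {E : Type*} [AddCommGroup E] [Module ℝ E] {a : Fin (d + 1) → E}
    {l : Fin d → ℝ} (hl : l ∈ openSimplex d) :
    a 0 + ∑ i, l i • (a i.succ - a 0) ∈ openFacet a := by
  refine ⟨Fin.cons (1 - ∑ i, l i) l, fun i => ?_, ?_, ?_⟩
  · refine Fin.cases ?_ (fun i => ?_) i
    · simpa using hl.2
    · simpa using hl.1 i
  · rw [Fin.sum_univ_succ]; simp
  · rw [Fin.sum_univ_succ]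
    simp only [Fin.cons_zero, Fin.cons_succ, smul_sub, Finset.sum_sub_distrib, ← Finset.sum_smul]
    module

lemma exists_of_mem_openFacet {E : Type*} [AddCommGroup E] [Module ℝ E] {a : Fin (d + 1) → E}
    {x : E} (hx : x ∈ openFacet a) :
    (∃ l ∈ openSimplex d, a 0 + ∑ i, l i • (a i.succ - a 0) = x) := by
  obtain ⟨l, hl0, hl1, rfl⟩ := hx
  rw [Fin.sum_univ_succ] at hl1
  refine ⟨fun i => l i.succ, ⟨fun i => hl0 _, by linarith [hl0 0]⟩, ?_⟩
  rw [Fin.sum_univ_succ]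
  simp only [smul_sub, Finset.sum_sub_distrib, ← Finset.sum_smul]
  rw [show ∑ i : Fin d, l i.succ = 1 - l 0 by linarith]
  module

lemma linearIndependent_cons_normal {E : Type*} [NormedAddCommGroup E] [InnerProductSpace ℝ E]
    {c : Fin d → E} (hc : LinearIndependent ℝ c) {y : E} (hy : y ≠ 0) (hyc : ∀ i, ⟪y, c i⟫ = 0) :
    LinearIndependent ℝ (Fin.cons y c : Fin (d + 1) → E) := by
  rw [linearIndependent_finCons]
  refine ⟨hc, fun hmem => hy ?_⟩
  have : Submodule.span ℝ (Set.range c) ≤ (ℝ ∙ y)ᗮ := by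
    rw [Submodule.span_le]
    rintro _ ⟨i, rfl⟩
    exact Submodule.mem_orthogonal_singleton_iff_inner_right.2 (hyc i)
  exact inner_self_eq_zero.1 (Submodule.mem_orthogonal_singleton_iff_inner_right.1 (this hmem))

lemma measurableSet_normalPrism {a : Fin (d + 1) → EuclideanSpace ℝ (Fin (d + 1))}
    {y : EuclideanSpace ℝ (Fin (d + 1))}
    (hc : LinearIndependent ℝ fun i : Fin d => a i.succ - a 0) (hy : y ≠ 0)
    (hyc : ∀ i : Fin d, ⟪y, a i.succ - a 0⟫ = 0) : MeasurableSet (normalPrism a y) := by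
  have hli := linearIndependent_cons_normal hc hy hyc
  let b := basisOfLinearIndependentOfCardEqFinrank hli (by simp)
  have hb0 : b 0 = y := by simp [b]
  have hbs : ∀ i : Fin d, b i.succ = a i.succ - a 0 := fun i => by simp [b]
  have heq : normalPrism a y = {z | 0 ≤ b.coord 0 (z - a 0)} ∩
      (fun z => fun i : Fin d => b.coord i.succ (z - a 0)) ⁻¹' openSimplex d := by
    ext z
    constructor
    · rintro ⟨x, hx, r, hr, rfl⟩
      obtain ⟨l, hl, rfl⟩ := exists_of_mem_openFacet hx
      have h1 : a 0 + ∑ i, l i • (a i.succ - a 0) + r • y - a 0 =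
          r • b 0 + ∑ i, l i • b i.succ := by
        simp only [hb0, hbs]; abel
      constructor
      · simp only [Set.mem_ofPred_eq, h1, map_add, map_smul, map_sum, Basis.coord_apply, Basis.repr_self]
        simp [hr]
      · simp only [Set.mem_preimage, h1, map_add, map_smul, map_sum, Basis.coord_apply, Basis.repr_self]
        convert hl using 1
        ext i
        simp [Finsupp.single_apply]
    · rintro ⟨h0, hl⟩
      refine ⟨_, add_sum_mem_openFacet hl, _, h0, ?_⟩
      have h1 := b.sum_repr (z - a 0)
      rw [Fin.sum_univ_succ] at h1
      simp only [hb0, hbs] at h1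
      simp only [Basis.coord_apply]
      rw [add_assoc, add_comm (∑ i, _), h1]
      abel
  have hcont : ∀ i, Continuous fun z => b.coord i (z - a 0) := fun i =>
    (LinearMap.continuous_of_finiteDimensional (b.coord i)).comp (by fun_prop)
  rw [heq]
  refine (measurableSet_le measurable_const (hcont 0).measurable).inter ?_
  exact (measurable_pi_lambda _ fun i => (hcont i.succ).measurable) (measurableSet_openSimplex d)

/-- The part of the boundary of a bounded closed set lying over a simplex has at least the area
of the simplex. -/
lemma le_measure_frontier_inter_normalPrism {K : Set (EuclideanSpace ℝ (Fin (d + 1)))}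
    (hK : IsClosed K) (hKb : Bornology.IsBounded K)
    {a : Fin (d + 1) → EuclideanSpace ℝ (Fin (d + 1))} {y : EuclideanSpace ℝ (Fin (d + 1))}
    (hy : y ≠ 0) (hyc : ∀ i : Fin d, ⟪y, a i.succ - a 0⟫ = 0) (ha : openFacet a ⊆ K) :
    ENNReal.ofReal (√(Matrix.gram ℝ fun i : Fin d => a i.succ - a 0).det / (d ! : ℝ)) ≤
      μHE[d] (frontier K ∩ normalPrism a y) := by
  set U := (ℝ ∙ y)ᗮ with hU
  have hUd : finrank ℝ U = d := by
    have : Fact (finrank ℝ (EuclideanSpace ℝ (Fin (d + 1))) = d + 1) := ⟨by simp⟩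
    exact Submodule.finrank_orthogonal_span_singleton hy
  let e : OrthonormalBasis (Fin d) ℝ U := (stdOrthonormalBasis ℝ U).reindex (finCongr hUd)
  -- Orthogonal projection along `y` does not increase area and preserves the Gram matrix of the
  -- edges. Each point of the open simplex has the same image as the boundary point of `K` on its
  -- ray.
  let pr : EuclideanSpace ℝ (Fin (d + 1)) →L[ℝ] EuclideanSpace ℝ (Fin d) :=
    (e.repr : U ≃L[ℝ] EuclideanSpace ℝ (Fin d)).toContinuousLinearMap.comp U.orthogonalProjectionOnto
  have hpr : ∀ x, pr x = e.repr (U.orthogonalProjectionOnto x) := fun x => rfl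
  have hLip : LipschitzWith 1 pr := by
    refine LipschitzWith.of_dist_le_mul fun x z => ?_
    rw [NNReal.coe_one, one_mul, dist_eq_norm, dist_eq_norm, ← map_sub, hpr,
      LinearIsometryEquiv.norm_map]
    exact U.norm_orthogonalProjectionOnto_apply_le (x - z)
  have hpry : pr y = 0 := by
    rw [hpr]
    have : U.orthogonalProjectionOnto y = 0 := by
      rw [Submodule.orthogonalProjectionOnto_eq_zero_iff, hU]
      exact Submodule.le_orthogonal_orthogonal _ (Submodule.mem_span_singleton_self y)
    rw [this, map_zero]
  have hcU : ∀ i : Fin d, a i.succ - a 0 ∈ U := fun i =>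
    Submodule.mem_orthogonal_singleton_iff_inner_right.2 (hyc i)
  have hgram : Matrix.gram ℝ (fun i : Fin d => pr (a i.succ - a 0)) =
      Matrix.gram ℝ fun i : Fin d => a i.succ - a 0 := by
    ext i j
    rw [Matrix.gram_apply, Matrix.gram_apply, hpr, hpr, LinearIsometryEquiv.inner_map_map,
      Submodule.coe_inner]
    have hp : ∀ x ∈ U, ((U.orthogonalProjectionOnto x : U) : EuclideanSpace ℝ (Fin (d + 1))) = x :=
      fun x hx => congrArg Subtype.val (U.orthogonalProjectionOnto_mem_subspace_eq_self ⟨x, hx⟩)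
    rw [hp _ (hcU i), hp _ (hcU j)]
  rw [← hgram]
  refine (le_volume_simplex (pr (a 0)) _).trans ?_
  rw [← EuclideanSpace.euclideanHausdorffMeasure_eq_volume]
  refine le_trans (measure_mono ?_) (euclideanHausdorffMeasure_image_le hLip d _)
  rintro _ ⟨l, hl, rfl⟩
  have hx := add_sum_mem_openFacet (a := a) hl
  obtain ⟨r, hr, hmem⟩ := exists_mem_frontier_ray hK hKb (ha hx) hy
  refine ⟨_, ⟨hmem, _, hx, r, hr, rfl⟩, ?_⟩
  simp only [map_add, map_smul, map_sum, hpry, smul_zero, add_zero]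

/-- The prisms over different facets of a convex set in direction of outer normals are disjoint. -/
lemma openFacet_inter_of_normalPrism_inter {E : Type*} [NormedAddCommGroup E]
    [InnerProductSpace ℝ E] {P : Set E} {q y y' z : E} {a a' : Fin (d + 1) → E}
    (hP : Convex ℝ P) (ha : ∀ i, a i ∈ P) (ha' : ∀ i, a' i ∈ P)
    (hy : ∀ i, ⟪y, a i - q⟫ = 1) (hy' : ∀ i, ⟪y', a' i - q⟫ = 1)
    (hyP : ∀ p ∈ P, ⟪y, p - q⟫ ≤ 1) (hyP' : ∀ p ∈ P, ⟪y', p - q⟫ ≤ 1)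
    (hz : z ∈ normalPrism a y) (hz' : z ∈ normalPrism a' y') :
    ∃ x, x ∈ openFacet a ∧ x ∈ openFacet a' := by
  have key : ∀ {b : Fin (d + 1) → E} {w x : E}, (∀ i, b i ∈ P) → (∀ i, ⟪w, b i - q⟫ = 1) →
      x ∈ openFacet b → x ∈ P ∧ ⟪w, x - q⟫ = 1 := by
    rintro b w _ hb hw ⟨l, hl0, hl1, rfl⟩
    refine ⟨hP.sum_mem (fun i _ => (hl0 i).le) hl1 fun i _ => hb i, ?_⟩
    have : ∑ i, l i • b i - q = ∑ i, l i • (b i - q) := by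
      simp only [smul_sub, Finset.sum_sub_distrib, ← Finset.sum_smul, hl1, one_smul]
    rw [this, inner_sum]
    simp only [real_inner_smul_right, hw, mul_one, hl1]
  obtain ⟨x, hx, r, hr, rfl⟩ := hz
  obtain ⟨x', hx', r', hr', heq⟩ := hz'
  obtain ⟨hxP, hx1⟩ := key ha hy hx
  obtain ⟨hxP', hx1'⟩ := key ha' hy' hx'
  have h1 : ⟪y, x' - x⟫ ≤ 0 := by
    rw [← sub_sub_sub_cancel_right x' x q, inner_sub_right, hx1]
    linarith [hyP x' hxP']
  have h2 : ⟪y', x - x'⟫ ≤ 0 := by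
    rw [← sub_sub_sub_cancel_right x x' q, inner_sub_right, hx1']
    linarith [hyP' x hxP]
  have h3 : x - x' = r' • y' - r • y := by
    rw [sub_eq_sub_iff_add_eq_add, add_comm (r' • y'), ← heq, add_comm]
  -- Both terms are nonpositive because `y` and `y'` are outer normals at `x` and `x'`; so the base
  -- points coincide.
  have h4 : ⟪x - x', x - x'⟫ = r' * ⟪y', x - x'⟫ + r * ⟪y, x' - x⟫ := by
    conv_lhs => rw [h3, inner_sub_left, real_inner_smul_left, real_inner_smul_left, ← h3]
    rw [← neg_sub x x', inner_neg_right]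
    ring
  have h5 : ⟪x - x', x - x'⟫ = 0 := by
    refine le_antisymm ?_ real_inner_self_nonneg
    rw [h4]
    have := mul_nonpos_of_nonneg_of_nonpos hr' h2
    have := mul_nonpos_of_nonneg_of_nonpos hr h1
    linarith
  have h6 : x = x' := sub_eq_zero.1 (inner_self_eq_zero.1 h5)
  exact ⟨x, hx, h6 ▸ hx'⟩

end Prism

/-! ### Finiteness of the surface area. -/

section SurfaceFinite

/-- This is the nearest-point map; the obtuse-angle inequality characterises its values and makes it
a contraction. -/
lemma exists_lipschitz_projection {E : Type*} [NormedAddCommGroup E] [InnerProductSpace ℝ E]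
    [CompleteSpace E] {K : Set E} (hK : IsClosed K) (hconv : Convex ℝ K) (hne : K.Nonempty) :
    ∃ π : E → E, LipschitzWith 1 π ∧
      ∀ u, ∀ v ∈ K, (∀ w ∈ K, ⟪u - v, w - v⟫ ≤ 0) → π u = v := by
  have hex : ∀ u, ∃ v ∈ K, ∀ w ∈ K, ⟪u - v, w - v⟫ ≤ 0 := by
    intro u
    obtain ⟨v, hv, h⟩ := exists_norm_eq_iInf_of_complete_convex hne hK.isComplete hconv u
    exact ⟨v, hv, (norm_eq_iInf_iff_real_inner_le_zero hconv hv).1 h⟩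
  choose π hπK hπ using hex
  have hmono : ∀ u u' v v', v ∈ K → v' ∈ K → (∀ w ∈ K, ⟪u - v, w - v⟫ ≤ 0) →
      (∀ w ∈ K, ⟪u' - v', w - v'⟫ ≤ 0) → ‖v - v'‖ ≤ ‖u - u'‖ := by
    intro u u' v v' hv hv' h h'
    have h1 := h v' hv'
    have h2 := h' v hv
    rcases (norm_nonneg (v - v')).eq_or_lt with h0 | h0
    · rw [← h0]; exact norm_nonneg _
    refine le_of_mul_le_mul_right ?_ h0
    refine le_trans ?_ (real_inner_le_norm (u - u') (v - v'))
    rw [← real_inner_self_eq_norm_mul_norm]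
    have h3 : ⟪u - u', v - v'⟫ - ⟪v - v', v - v'⟫ = -⟪u - v, v' - v⟫ - ⟪u' - v', v - v'⟫ := by
      rw [← neg_sub v v', inner_neg_right]
      simp only [inner_sub_left]
      ring
    linarith
  refine ⟨π, LipschitzWith.of_dist_le_mul fun u u' => ?_, fun u v hv h => ?_⟩
  · rw [NNReal.coe_one, one_mul, dist_eq_norm, dist_eq_norm]
    exact hmono u u' _ _ (hπK u) (hπK u') (hπ u) (hπ u')
  · have := hmono u u _ _ (hπK u) hv (hπ u) h
    rw [sub_self, norm_zero] at this
    exact sub_eq_zero.1 (norm_le_zero_iff.1 this)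

/-- The boundary of a convex body has finite area. -/
lemma measure_frontier_lt_top {d : ℕ} {K : Set (EuclideanSpace ℝ (Fin (d + 1)))} (hK : IsCompact K)
    (hconv : Convex ℝ K) (hint : (interior K).Nonempty) : μHE[d] (frontier K) < ⊤ := by
  obtain ⟨q, hq⟩ := hint
  obtain ⟨π, hπ, hπK⟩ := exists_lipschitz_projection hK.isClosed hconv ⟨q, interior_subset hq⟩
  obtain ⟨R, hR⟩ := (Metric.isBounded_iff_subset_closedBall 0).1 hK.isBounded
  let ins : Fin (d + 1) → Bool → EuclideanSpace ℝ (Fin d) → EuclideanSpace ℝ (Fin (d + 1)) :=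
    fun i s w => WithLp.toLp 2 (i.insertNth (if s then R else -R) w)
  have hins : ∀ i s, LipschitzWith 1 (ins i s) := by
    intro i s
    refine LipschitzWith.of_dist_le_mul fun w w' => ?_
    rw [NNReal.coe_one, one_mul, EuclideanSpace.dist_eq, EuclideanSpace.dist_eq,
      Fin.sum_univ_succAbove _ i]
    simp [ins]
  let Q : Set (EuclideanSpace ℝ (Fin (d + 1))) := {z | ∀ j, |z j| ≤ R}
  let D : Set (EuclideanSpace ℝ (Fin d)) := {z | ∀ j, |z j| ≤ R}
  have hbdd : ∀ m : ℕ, Bornology.IsBounded {z : EuclideanSpace ℝ (Fin m) | ∀ j, |z j| ≤ R} := by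
    intro m
    refine (Metric.isBounded_iff_subset_closedBall 0).2 ⟨√(∑ j : Fin m, R ^ 2), fun z hz => ?_⟩
    rw [mem_closedBall_zero_iff, EuclideanSpace.norm_eq]
    refine Real.sqrt_le_sqrt (Finset.sum_le_sum fun j _ => ?_)
    rw [Real.norm_eq_abs]
    exact pow_le_pow_left₀ (abs_nonneg _) (hz j) 2
  have hQc : IsClosed Q := by
    simp only [Q, Set.ofPred_forall]
    exact isClosed_iInter fun j => isClosed_le (by fun_prop) continuous_const
  have hKQ : K ⊆ Q := fun z hz j => by
    have h1 := mem_closedBall_zero_iff.1 (hR hz)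
    exact (PiLp.norm_apply_le z j).trans h1
  have hfr : ∀ z ∈ frontier Q, ∃ i s, ∃ w ∈ D, ins i s w = z := by
    intro z hz
    have hzQ : z ∈ Q := hQc.frontier_subset hz
    obtain ⟨i, hi⟩ : ∃ i, |z i| = R := by
      by_contra! hne
      refine hz.2 (mem_interior.2 ⟨{z | ∀ j, |z j| < R}, fun x hx j => (hx j).le, ?_,
        fun j => lt_of_le_of_ne (hzQ j) (hne j)⟩)
      simp only [Set.ofPred_forall]
      exact isOpen_iInter_of_finite fun j => isOpen_lt (by fun_prop) continuous_const
    refine ⟨i, decide (0 ≤ z i), WithLp.toLp 2 (fun j => z (i.succAbove j)),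
      fun j => hzQ _, ?_⟩
    have hzi : (if decide (0 ≤ z i) = true then R else -R) = z i := by
      by_cases h0 : 0 ≤ z i
      · simp [h0, ← hi, abs_of_nonneg h0]
      · simp [h0, ← hi, abs_of_neg (not_le.1 h0)]
    simp only [ins, hzi]
    ext j
    refine Fin.succAboveCases i ?_ (fun j => ?_) j <;> simp
  -- A boundary point is the nearest point of `K` to every point on its outer normal ray, and this
  -- ray meets the boundary of the cube `Q`. So the contraction `π` maps the finitely many cube
  -- faces onto a superset of the boundary of `K`.
  have hcover : frontier K ⊆ ⋃ i, ⋃ s, π '' (ins i s '' D) := by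
    intro x hx
    obtain ⟨y, hy1, hyK⟩ := exists_supporting_functional hconv hq hx
    have hy0 : y ≠ 0 := by rintro rfl; simp at hy1
    have hxK : x ∈ K := hK.isClosed.frontier_subset hx
    obtain ⟨r, hr, hmem⟩ := exists_mem_frontier_ray hQc (hbdd _) (hKQ hxK) hy0
    obtain ⟨i, s, w, hw, heq⟩ := hfr _ hmem
    refine Set.mem_iUnion.2 ⟨i, Set.mem_iUnion.2 ⟨s, _, ⟨w, hw, rfl⟩, ?_⟩⟩
    rw [heq]
    refine hπK _ x hxK fun p hp => ?_
    rw [add_sub_cancel_left, real_inner_smul_left]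
    refine mul_nonpos_of_nonneg_of_nonpos hr ?_
    rw [← sub_sub_sub_cancel_right p x q, inner_sub_right, hy1]
    linarith [hyK p hp]
  refine (measure_mono hcover).trans_lt ?_
  refine (measure_iUnion_fintype_le _ _).trans_lt (ENNReal.sum_lt_top.2 fun i _ => ?_)
  refine (measure_iUnion_fintype_le _ _).trans_lt (ENNReal.sum_lt_top.2 fun s _ => ?_)
  refine (euclideanHausdorffMeasure_image_le hπ d _).trans_lt ?_
  refine (euclideanHausdorffMeasure_image_le (hins i s) d _).trans_lt ?_
  rw [EuclideanSpace.euclideanHausdorffMeasure_eq_volume]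
  exact (hbdd d).measure_lt_top

end SurfaceFinite

/-! ### Assembling the bound. -/

section Main

variable {d : ℕ}

lemma linearIndependent_edges {E : Type*} [AddCommGroup E] [Module ℝ E] {a : Fin (d + 1) → E}
    {q : E} (h : LinearIndependent ℝ fun i => a i - q) :
    LinearIndependent ℝ fun i : Fin d => a i.succ - a 0 := by
  rw [Fintype.linearIndependent_iff] at h ⊢
  intro g hg i
  refine h (Fin.cons (-∑ i, g i) g) ?_ i.succ
  rw [Fin.sum_univ_succ]
  simp only [Fin.cons_zero, Fin.cons_succ]
  rw [← hg]
  simp only [smul_sub, Finset.sum_sub_distrib, neg_smul, Finset.sum_smul]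
  abel

/-- A small step along `y` stays in `P` and increases the functional. Interior lattice points are
thus off every facet hyperplane, as `card_crossing_le` requires. -/
lemma inner_lt_one_of_mem_interior {E : Type*} [NormedAddCommGroup E] [InnerProductSpace ℝ E]
    {P : Set E} {q y z : E} (hy : y ≠ 0) (hyP : ∀ p ∈ P, ⟪y, p - q⟫ ≤ 1) (hz : z ∈ interior P) :
    ⟪y, z - q⟫ < 1 := by
  have hc : Continuous fun ε : ℝ => z + ε • y := by fun_prop
  have hev : ∀ᶠ ε in nhdsWithin (0 : ℝ) (Set.Ioi 0), z + ε • y ∈ interior P :=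
    nhdsWithin_le_nhds ((hc.tendsto 0).eventually (by
      simpa using isOpen_interior.mem_nhds hz))
  obtain ⟨ε, h1, hε⟩ := (hev.and self_mem_nhdsWithin).exists
  have h2 := hyP _ (interior_subset h1)
  have h3 : z + ε • y - q = (z - q) + ε • y := by abel
  rw [h3, inner_add_right, real_inner_smul_right] at h2
  have h4 := mul_pos (show 0 < ε from hε) (real_inner_self_pos.2 hy)
  linarith

/-- The facets of a triangulated polytope inside a convex body have total area at most the surface
area of the body. -/
lemma sum_sqrt_det_gram_le (K : ConvexBody (EuclideanSpace ℝ (Fin (d + 1))))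
    {P : Set (EuclideanSpace ℝ (Fin (d + 1)))} (hP : Convex ℝ P) (hPK : P ⊆ K)
    {q : EuclideanSpace ℝ (Fin (d + 1))} (hq : q ∈ interior P) {N : ℕ}
    {a : Fin N → Fin (d + 1) → EuclideanSpace ℝ (Fin (d + 1))}
    {y : Fin N → EuclideanSpace ℝ (Fin (d + 1))} (haP : ∀ k i, a k i ∈ P)
    (hali : ∀ k, LinearIndependent ℝ (fun i => a k i - q))
    (hya : ∀ k i, ⟪y k, a k i - q⟫ = 1) (hyP : ∀ k, ∀ p ∈ P, ⟪y k, p - q⟫ ≤ 1)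
    (hdisj : ∀ k k' (l m : Fin (d + 1) → ℝ), (∀ i, 0 < l i) → (∀ i, 0 ≤ m i) →
        ∑ i, l i • (a k i - q) = ∑ i, m i • (a k' i - q) → k' = k) :
    ∑ k, √(Matrix.gram ℝ fun i : Fin d => a k i.succ - a k 0).det ≤ (d ! : ℝ) * surfaceArea K := by
  have hy0 : ∀ k, y k ≠ 0 := fun k h0 => by
    have := hya k 0
    rw [h0, inner_zero_left] at this
    exact zero_ne_one this
  have hyc : ∀ k, ∀ i : Fin d, ⟪y k, a k i.succ - a k 0⟫ = 0 := fun k i => by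
    rw [← sub_sub_sub_cancel_right _ _ q, inner_sub_right, hya, hya, sub_self]
  have hKclosed := K.isCompact.isClosed
  have hfacet : ∀ k, openFacet (a k) ⊆ K := by
    rintro k _ ⟨l, hl0, hl1, rfl⟩
    exact hPK (hP.sum_mem (fun i _ => (hl0 i).le) hl1 fun i _ => haP k i)
  have hpair : Pairwise fun k k' => Disjoint
      (frontier (K : Set (EuclideanSpace ℝ (Fin (d + 1)))) ∩ normalPrism (a k) (y k))
      (frontier (K : Set (EuclideanSpace ℝ (Fin (d + 1)))) ∩ normalPrism (a k') (y k')) := by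
    intro k k' hne
    refine Set.disjoint_left.2 fun z hz hz' => hne ?_
    obtain ⟨x, ⟨l, hl0, hl1, hlx⟩, m, hm0, hm1, hmx⟩ := openFacet_inter_of_normalPrism_inter hP
      (haP k) (haP k') (hya k) (hya k') (hyP k) (hyP k') hz.2 hz'.2
    refine (hdisj k k' l m hl0 (fun i => (hm0 i).le) ?_).symm
    simp only [smul_sub, Finset.sum_sub_distrib, ← Finset.sum_smul, hl1, hm1, hlx, hmx]
  have hmeas : ∀ k, MeasurableSet
      (frontier (K : Set (EuclideanSpace ℝ (Fin (d + 1)))) ∩ normalPrism (a k) (y k)) := fun k =>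
    isClosed_frontier.measurableSet.inter
      (measurableSet_normalPrism (linearIndependent_edges (hali k)) (hy0 k) (hyc k))
  have hle : ∑ k, ENNReal.ofReal
      (√(Matrix.gram ℝ fun i : Fin d => a k i.succ - a k 0).det / (d ! : ℝ)) ≤
      μHE[d] (frontier (K : Set (EuclideanSpace ℝ (Fin (d + 1))))) := by
    calc _ ≤ ∑ k, μHE[d] (frontier (K : Set (EuclideanSpace ℝ (Fin (d + 1)))) ∩
          normalPrism (a k) (y k)) := Finset.sum_le_sum fun k _ =>
        le_measure_frontier_inter_normalPrism hKclosed K.isCompact.isBounded (hy0 k) (hyc k)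
          (hfacet k)
      _ = μHE[d] (⋃ k, frontier (K : Set (EuclideanSpace ℝ (Fin (d + 1)))) ∩
          normalPrism (a k) (y k)) := by
        rw [measure_iUnion hpair hmeas, tsum_fintype]
      _ ≤ _ := measure_mono (Set.iUnion_subset fun k => Set.inter_subset_left)
  -- Without finiteness `toReal` would turn an infinite area into `0`.
  have hfin := measure_frontier_lt_top K.isCompact K.convex ⟨q, interior_mono hPK hq⟩
  rw [← ENNReal.ofReal_sum_of_nonneg fun k _ => by positivity,
    ENNReal.ofReal_le_iff_le_toReal hfin.ne, ← Finset.sum_div, div_le_iff₀ (by positivity)] at hle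
  rw [mul_comm]
  exact hle

/-- The number of lattice points in a convex body which contains `d + 2` affinely independent
lattice points. -/
lemma ncard_inter_lattice_le (L : Submodule ℤ (EuclideanSpace ℝ (Fin (d + 1))))
    [DiscreteTopology L] [IsZLattice ℝ L] (K : ConvexBody (EuclideanSpace ℝ (Fin (d + 1))))
    (hK : finrank ℝ (vectorSpan ℝ ((K : Set (EuclideanSpace ℝ (Fin (d + 1)))) ∩ L)) = d + 1) :
    ((((K : Set (EuclideanSpace ℝ (Fin (d + 1)))) ∩ L).ncard : ℕ) : ℝ) ≤
      (volume (K : Set (EuclideanSpace ℝ (Fin (d + 1))))).toReal / ZLattice.covolume L +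
        (inhomogeneousMinimum L * firstMinimum (polarLattice L) + 1) * (d ! : ℝ) *
          (surfaceArea K / minSublatticeDet L d) := by
  classical
  set S := (K : Set (EuclideanSpace ℝ (Fin (d + 1)))) ∩ L with hS
  have hSfin : S.Finite := finite_inter_lattice L K.isCompact.isBounded
  have hSne : S.Nonempty := by
    by_contra h
    rw [Set.not_nonempty_iff_eq_empty] at h
    rw [h, vectorSpan_empty, finrank_bot] at hK
    omega
  have hspan : affineSpan ℝ S = ⊤ := by
    rw [AffineSubspace.affineSpan_eq_top_iff_vectorSpan_eq_top_of_nonempty ℝ _ _ hSne]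
    exact Submodule.eq_top_of_finrank_eq (by rw [hK]; simp)
  obtain ⟨q, hq⟩ := interior_convexHull_nonempty_iff_affineSpan_eq_top.2 hspan
  obtain ⟨N, a, y, haS, hali, hya, hyP, hdisj, hcov, hN⟩ :=
    exists_boundary_triangulation (d := d) (by simp) hSfin hq
  set P := convexHull ℝ S with hP
  have hPconv : Convex ℝ P := convex_convexHull ℝ S
  have hPc : IsCompact P := hSfin.isCompact_convexHull ℝ
  have hPK : P ⊆ K := convexHull_min Set.inter_subset_left K.convex
  have hSP : S ⊆ P := subset_convexHull ℝ S
  obtain ⟨t, htV, htgen, htle⟩ := exists_translate_ncard_le L hPc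
  have hμ := norm_le_inhomogeneousMinimum htV
  have hpos := ZLattice.covolume_pos L
  set s : Fin N → ℝ := fun k => √(Matrix.gram ℝ fun i : Fin d => a k i.succ - a k 0).det with hs
  have hsum : ∑ k, s k ≤ (d ! : ℝ) * surfaceArea K :=
    sum_sqrt_det_gram_le K hPconv hPK hq (fun k i => hSP (haS k i)) hali hya hyP hdisj
  have hli : ∀ k, LinearIndependent ℝ fun i : Fin d => a k i.succ - a k 0 := fun k =>
    linearIndependent_edges (hali k)
  let a' : Fin N → Fin (d + 1) → L := fun k i => ⟨a k i, (haS k i).2⟩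
  have hmin : ∀ k, minSublatticeDet L d ≤ s k := fun k =>
    minSublatticeDet_le (c := fun i : Fin d => a' k i.succ - a' k 0) (hli k)
  have hy0 : ∀ k, y k ≠ 0 := fun k h0 => by
    have := hya k 0
    rw [h0, inner_zero_left] at this
    exact zero_ne_one this
  have hyc : ∀ k, ∀ i : Fin d, ⟪y k, a k i.succ - a k 0⟫ = 0 := fun k i => by
    rw [← sub_sub_sub_cancel_right _ _ q, inner_sub_right, hya, hya, sub_self]
  have hZfin : {z : L | (z : EuclideanSpace ℝ (Fin (d + 1))) ∈ S}.Finite :=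
    hSfin.preimage Subtype.val_injective.injOn
  set Z := hZfin.toFinset with hZ
  have hmemZ : ∀ z : L, z ∈ Z ↔ (z : EuclideanSpace ℝ (Fin (d + 1))) ∈ S := fun z => by simp [hZ]
  have hZcard : S.ncard = Z.card := by
    rw [← Set.ncard_coe_finset, ← Set.ncard_image_of_injective _ Subtype.val_injective]
    congr 1
    ext x
    constructor
    · intro hx; exact ⟨⟨x, hx.2⟩, by simpa [hmemZ] using hx, rfl⟩
    · rintro ⟨z, hz, rfl⟩; exact (hmemZ z).1 hz
  let A := Z.filter fun z : L => (z + t : EuclideanSpace ℝ (Fin (d + 1))) ∈ P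
  let C := Z.filter fun z : L => (z : EuclideanSpace ℝ (Fin (d + 1))) ∈ frontier P
  let T : Fin N → Finset L := fun k => Z.filter fun z : L =>
    (z : EuclideanSpace ℝ (Fin (d + 1))) ∈ interior P ∧
    ∃ r : ℝ, 0 < r ∧ r < 1 ∧ ∃ l : Fin (d + 1) → ℝ, (∀ i, 0 ≤ l i) ∧
      ∑ i, l i = 1 ∧ ∑ i, l i • a k i = z + r • t
  -- Points that stay in `P`, points on the boundary, and interior points whose segment leaves
  -- through the `k`-th simplex.
  have hcover : Z ⊆ (A ∪ C) ∪ Finset.univ.biUnion T := by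
    intro z hz
    by_cases hA : (z + t : EuclideanSpace ℝ (Fin (d + 1))) ∈ P
    · exact Finset.mem_union_left _ (Finset.mem_union_left _ (Finset.mem_filter.2 ⟨hz, hA⟩))
    by_cases hC : (z : EuclideanSpace ℝ (Fin (d + 1))) ∈ frontier P
    · exact Finset.mem_union_left _ (Finset.mem_union_right _ (Finset.mem_filter.2 ⟨hz, hC⟩))
    have hzP : (z : EuclideanSpace ℝ (Fin (d + 1))) ∈ P := hSP ((hmemZ z).1 hz)
    have hzi : (z : EuclideanSpace ℝ (Fin (d + 1))) ∈ interior P := by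
      by_contra h
      exact hC (hPc.isClosed.frontier_eq ▸ ⟨hzP, h⟩)
    obtain ⟨r, hr0, hr1, hr⟩ := exists_mem_frontier_segment hPc.isClosed hzP hA
    obtain ⟨k, l, hl⟩ := hcov _ hr
    refine Finset.mem_union_right _ (Finset.mem_biUnion.2 ⟨k, Finset.mem_univ _,
      Finset.mem_filter.2 ⟨hz, hzi, r, lt_of_le_of_ne hr0 ?_, hr1, l, hl⟩⟩)
    rintro rfl
    exact hC (by simpa using hr)
  have hAcard : (A.card : ℝ) ≤ (volume P).toReal / ZLattice.covolume L := by
    rw [le_div_iff₀ hpos]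
    refine le_trans (mul_le_mul_of_nonneg_right ?_ hpos.le) htle
    rw [← Set.ncard_coe_finset]
    exact_mod_cast Set.ncard_le_ncard (fun z hz => (Finset.mem_filter.1 hz).2)
      (finite_setOf_add_mem L hPc t)
  have hCcard : C.card ≤ N := by
    refine le_trans ?_ hN
    rw [← Set.ncard_coe_finset, ← Set.ncard_image_of_injective _ Subtype.val_injective]
    refine Set.ncard_le_ncard ?_ (hSfin.subset Set.inter_subset_left)
    rintro _ ⟨z, hz, rfl⟩
    have := Finset.mem_filter.1 hz
    exact ⟨(hmemZ z).1 this.1, this.2⟩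
  have hTcard : ∀ k, ((T k).card : ℝ) ≤ inhomogeneousMinimum L * s k / ZLattice.covolume L := by
    intro k
    rw [le_div_iff₀ hpos]
    have h1 := card_crossing_le (a := a' k) (hli k) htgen (T k)
      (fun z hz => (Finset.mem_filter.1 hz).2.2) (fun z hz h0 => by
        have hzi := (Finset.mem_filter.1 hz).2.1
        have hlt := inner_lt_one_of_mem_interior (hy0 k) (hyP k) hzi
        have h2 := abs_hyperplaneForm (hli k) (v := (‖y k‖⁻¹ : ℝ) • y k)
          (norm_smul_inv_norm (hy0 k)) (fun i => by
            rw [real_inner_smul_left, hyc, mul_zero]) (z - a' k 0 : L)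
        have h3 := (Matrix.posDef_gram_of_linearIndependent (hli k)).det_pos
        have h4 := (Real.sqrt_pos.2 h3).ne'
        have h5 : hyperplaneForm (fun i : Fin d => a k i.succ - a k 0)
          ((z - a' k 0 : L) : EuclideanSpace ℝ (Fin (d + 1))) = 0 := h0
        rw [h5, abs_zero, eq_comm, mul_eq_zero, or_iff_left h4, abs_eq_zero, real_inner_smul_left,
          mul_eq_zero, or_iff_right (inv_ne_zero (norm_ne_zero_iff.2 (hy0 k))),
          AddSubgroupClass.coe_sub] at h2
        have h6 : (z : EuclideanSpace ℝ (Fin (d + 1))) - a' k 0 = (z - q) - (a k 0 - q) := by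
          simp [a']
        rw [h6, inner_sub_right, hya] at h2
        linarith)
    refine h1.trans ((abs_hyperplaneForm_le (hli k) t).trans ?_)
    exact mul_le_mul_of_nonneg_right hμ (Real.sqrt_nonneg _)
  have htotal : (S.ncard : ℝ) ≤ (volume P).toReal / ZLattice.covolume L + N +
      ∑ k, inhomogeneousMinimum L * s k / ZLattice.covolume L := by
    have h1 : Z.card ≤ A.card + C.card + ∑ k, (T k).card :=
      (Finset.card_le_card hcover).trans ((Finset.card_union_le _ _).trans
        (add_le_add (Finset.card_union_le _ _) Finset.card_biUnion_le))
    rw [hZcard]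
    calc (Z.card : ℝ) ≤ A.card + C.card + ∑ k, ((T k).card : ℝ) := by exact_mod_cast h1
      _ ≤ _ := add_le_add (add_le_add hAcard (by exact_mod_cast hCcard))
        (Finset.sum_le_sum fun k _ => hTcard k)
  have hvol : (volume P).toReal ≤ (volume (K : Set (EuclideanSpace ℝ (Fin (d + 1))))).toReal :=
    ENNReal.toReal_mono K.isCompact.measure_lt_top.ne (measure_mono hPK)
  set m := minSublatticeDet L d with hm
  have hmeq : m = firstMinimum (polarLattice L) * ZLattice.covolume L := minSublatticeDet_eq L
  have hlam := firstMinimum_polarLattice_pos L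
  have hmpos : 0 < m := hmeq ▸ mul_pos hlam hpos
  have hNle : (N : ℝ) ≤ (∑ k, s k) / m := by
    rw [le_div_iff₀ hmpos]
    have := Finset.card_nsmul_le_sum Finset.univ s m fun k _ => hmin k
    simpa using this
  have hμ0 : 0 ≤ inhomogeneousMinimum L := (norm_nonneg t).trans hμ
  -- Replacing `1 / det Λ` by `λ₁(Λ*) / det Λ_d` brings this to the same form as the bound for `N`.
  have hTsum : ∑ k, inhomogeneousMinimum L * s k / ZLattice.covolume L =
      inhomogeneousMinimum L * firstMinimum (polarLattice L) * ((∑ k, s k) / m) := by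
    rw [← Finset.sum_div, ← Finset.mul_sum, hmeq]
    field_simp
  calc (S.ncard : ℝ) ≤ _ := htotal
    _ ≤ (volume (K : Set (EuclideanSpace ℝ (Fin (d + 1))))).toReal / ZLattice.covolume L +
        (∑ k, s k) / m +
        inhomogeneousMinimum L * firstMinimum (polarLattice L) * ((∑ k, s k) / m) := by
      rw [hTsum]
      gcongr
    _ = (volume (K : Set (EuclideanSpace ℝ (Fin (d + 1))))).toReal / ZLattice.covolume L +
        (inhomogeneousMinimum L * firstMinimum (polarLattice L) + 1) * ((∑ k, s k) / m) := by ring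
    _ ≤ (volume (K : Set (EuclideanSpace ℝ (Fin (d + 1))))).toReal / ZLattice.covolume L +
        (inhomogeneousMinimum L * firstMinimum (polarLattice L) + 1) *
          ((d ! : ℝ) * surfaceArea K / m) := by
      gcongr
    _ = _ := by ring

end Main

end LatticeGeometry

theorem theorem4p1 (n : ℕ) (hn : 1 ≤ n)
    (L : Submodule ℤ (EuclideanSpace ℝ (Fin n))) [DiscreteTopology L] [IsZLattice ℝ L]
    (K : ConvexBody (EuclideanSpace ℝ (Fin n)))
    (hK : finrank ℝ (vectorSpan ℝ
      ((K : Set (EuclideanSpace ℝ (Fin n))) ∩ (L : Set (EuclideanSpace ℝ (Fin n))))) = n) :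
    ((K : Set (EuclideanSpace ℝ (Fin n))) ∩ (L : Set (EuclideanSpace ℝ (Fin n)))).Finite ∧
    ((((K : Set (EuclideanSpace ℝ (Fin n))) ∩
        (L : Set (EuclideanSpace ℝ (Fin n)))).ncard : ℕ) : ℝ) ≤
      (volume (K : Set (EuclideanSpace ℝ (Fin n)))).toReal / ZLattice.covolume L +
        (LatticeGeometry.inhomogeneousMinimum L *
            LatticeGeometry.firstMinimum (LatticeGeometry.polarLattice L) + 1) *
          ((n - 1)! : ℝ) *
          (LatticeGeometry.surfaceArea K / LatticeGeometry.minSublatticeDet L (n - 1)) := by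
  obtain ⟨d, rfl⟩ : ∃ d, n = d + 1 := ⟨n - 1, by omega⟩
  exact ⟨LatticeGeometry.finite_inter_lattice L K.isCompact.isBounded,
    LatticeGeometry.ncard_inter_lattice_le L K hK⟩
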